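/- **Amalgamated signatures.** A signature over a set $O$ is a set $A$ of operations with, for each $a\in A$, an arity $|a|\in\mathbb N$ and a typing function $\partial_a:\{0,1,\dots,|a|\}\to O$ ($\partial_a(0)$ is the output type, $\partial_a(1),\dots,\partial_a(|a|)$ the input types). A morphism $(A,\partial)\to(B,\partial)$ over a function $u:O\to Q$ is a function $f:A\to B$ with $|f(a)|=|a|$ together with, for each $a\in A$, a permutation $\sigma_a$ of $\{1,\dots,|a|\}$ (extended by $\sigma_a(0)=0$) such that $u\circ\partial_a\circ\sigma_a=\partial_{f(a)}$. For signatures $A,B$ over $O$ the tensor $A\otimes B$ has as operations the tuples $\langle a,b_i\rangle_{1\le i\le |a|}$ with $\partial_a(i)=\partial_{b_i}(0)$, with arity $\sum_i|b_i|$, output type $\partial_a(0)$, and input types those of $b_1,b_2,\dots$ placed one after the other; the unit $I_O$ has one operation $x\to x$ for each $x\in O$. The tensor of $(f,\sigma)$ and $(g,\tau)$ over the same $u$ sends $\langle a,b_i\rangle_i$ to $\langle f(a),g(b_{\sigma_a(j)})\rangle_j$, with permutation given by permuting the blocks by $\sigma_a$ and the positions inside the blocks by the $\tau$'s. A *(1-level)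 multicategory with non-standard amalgamation* over $O$ is a monoid, with respect to $\otimes$ and $I_O$, in the category of signatures over $O$ and morphisms over $\mathrm{id}_O$; a morphism over $u:O\to Q$ is a morphism of signatures over $u$ that commutes with the multiplications and the units. **Monads.** Consider the category whose objects are pairs $(O,S)$ with $O$ a set and $S$ a finitary (i.e. filtered-colimit preserving) cartesian monad on $Set_{/O}$ whose functor part preserves wide pullbacks. (A monad is cartesian if its functor part preserves pullbacks and all naturality squares of its unit and its multiplication are pullbacks.) A morphism $(O,S)\to(Q,T)$ over a function $u:O\to Q$ is a cartesian morphism of monads whose functor part is the pullback functor $u^*:Set_{/Q}\to Set_{/O}$, i.e. a natural transformation $\xi:S u^*\to u^*T$ all of whose naturality squares are pullbacks and which satisfies $$\xi\circ\eta^S_{u^*}=u^*(\eta^T),\qquad \xi\circ\mu^S_{u^*}=u^*(\mu^T)\circ\xi_T\circ S(\xi).$$ Morphisms are composed through the canonical isomorphisms $(v u)^*\cong u^*v^*$. **Corollary.** The projections (sending an object over $O$ to $O$ and a morphism over $u$ to $u$) of the category of multicategories with non-standard amalgamation and of the above category of monads to $Set$ are fibrations, and these two fibrations are equivalent over $Set$: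 there is an equivalence between the two categories whose functors, in both directions, commute with the projections to $Set$ and preserve prone (cartesian) morphisms, and whose unit and counit are vertical. -/

import Mathlib

open CategoryTheory CategoryTheory.Limits

universe u

/-! ## Amalgamated signatures -/

/-- An amalgamated signature over a set `O` of types: a set `Op` of operation symbols with a typing
function `∂ : Op → O† = ⋃ₙ O^{0,…,n}`. The function `∂_a : {0,…,n} → O` is given by `n = arity a`,
its value `out a` at `0`, and its restriction `inp a` to the `n` positive positions. -/
structure Signature (O : Type u) where
  Op : Type u
  arity : Op → ℕ
  out : Op → O
  inp : (a : Op) → Fin (arity a) → O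

/-- A morphism `(f, σ, u)` of amalgamated signatures over a function `u : O → Q`: a function `f`
on operations and, for each operation `a`, a bijection `σ_a` (the amalgamation permutation) from the
input positions of `f a` to those of `a`, with `∂_{f a} = u ∘ ∂_a ∘ σ_a`. -/
structure SigHom {O Q : Type u} (u : O → Q) (A : Signature O) (B : Signature Q) where
  toFun : A.Op → B.Op
  amalg : ∀ a, Fin (B.arity (toFun a)) ≃ Fin (A.arity a)
  out_toFun : ∀ a, B.out (toFun a) = u (A.out a)
  inp_toFun : ∀ a j, B.inp (toFun a) j = u (A.inp a (amalg a j))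

namespace SigHom

/-- The identity morphism of a signature, lying over the identity function. -/
def id {O : Type u} (A : Signature O) : SigHom (fun x : O => x) A A where
  toFun a := a
  amalg _ := Equiv.refl _
  out_toFun _ := rfl
  inp_toFun _ _ := rfl

/-- Composition of morphisms of signatures (first `f`, then `g`). -/
def comp {O Q R : Type u} {u : O → Q} {v : Q → R} {A : Signature O} {B : Signature Q}
    {C : Signature R} (f : SigHom u A B) (g : SigHom v B C) :
    SigHom (fun x => v (u x)) A C where
  toFun a := g.toFun (f.toFun a)
  amalg a := (g.amalg (f.toFun a)).trans (f.amalg a)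
  out_toFun a := by rw [g.out_toFun, f.out_toFun]
  inp_toFun a j := by rw [g.inp_toFun, f.inp_toFun]; rfl

/-- Two morphisms are equal if they agree on operations and the inverses of their amalgamation
permutations agree (as permutations of numbers). -/
theorem ext_amalg {O Q : Type u} {u : O → Q} {A : Signature O} {B : Signature Q}
    {f g : SigHom u A B} (h : ∀ a, f.toFun a = g.toFun a)
    (h' : ∀ a k, ((f.amalg a).symm k : ℕ) = (g.amalg a).symm k) : f = g := by
  obtain ⟨f, σ, _, _⟩ := f
  obtain ⟨g, τ, _, _⟩ := g
  obtain rfl : f = g := funext h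
  obtain rfl : σ = τ := funext fun a =>
    Equiv.symm_bijective.injective (Equiv.ext fun k => Fin.ext (h' a k))
  rfl

end SigHom

namespace Signature

variable {O Q R : Type u}

/-- Operations of the tensor `A ⊗ B`: tuples `⟨a, b_i⟩_i` with `b_i` an operation of `B` whose
output type is the `i`-th input type of `a`. -/
@[ext]
structure TensorOp (A B : Signature O) where
  fst : A.Op
  snd : Fin (A.arity fst) → B.Op
  compat : ∀ i, A.inp fst i = B.out (snd i)

/-- The (total) tensor of two signatures over `O`. The arity of `⟨a, b_i⟩_i` is `∑ i, |b_i|`, and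
the input positions of the `b_i` are placed one after the other. -/
def tensor (A B : Signature O) : Signature O where
  Op := TensorOp A B
  arity x := ∑ i, B.arity (x.snd i)
  out x := A.out x.fst
  inp x k := B.inp (x.snd (finSigmaFinEquiv.symm k).1) (finSigmaFinEquiv.symm k).2

theorem tensor_inp (A B : Signature O) (x : TensorOp A B)
    (p : (i : Fin (A.arity x.fst)) × Fin (B.arity (x.snd i))) :
    (tensor A B).inp x (finSigmaFinEquiv p) = B.inp (x.snd p.1) p.2 := by
  change B.inp (x.snd (finSigmaFinEquiv.symm (finSigmaFinEquiv p)).1) _ = _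
  rw [Equiv.symm_apply_apply]

/-- The unit signature over `O`: one unary operation `x → x` for each type `x`. -/
def unit (O : Type u) : Signature O where
  Op := O
  arity _ := 1
  out x := x
  inp x _ := x

/-- The tensor of two morphisms of signatures over the same function `u`:
`⟨a, b_i⟩_i ↦ ⟨f a, g b_{σ_a j}⟩_j`, with amalgamation permuting the blocks by `σ_a` and permuting
the positions within the blocks by the amalgamations of `g`. -/
def tensorHom {u : O → Q} {A B : Signature O} {A' B' : Signature Q}
    (f : SigHom u A A') (g : SigHom u B B') : SigHom u (tensor A B) (tensor A' B') where
  toFun x :=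
    { fst := f.toFun x.fst
      snd := fun j => g.toFun (x.snd (f.amalg x.fst j))
      compat := fun j => by rw [f.inp_toFun, g.out_toFun, x.compat] }
  amalg x :=
    finSigmaFinEquiv.symm.trans
      ((Equiv.sigmaCongr (f.amalg x.fst) (fun j => g.amalg (x.snd (f.amalg x.fst j)))).trans
        finSigmaFinEquiv)
  out_toFun x := f.out_toFun x.fst
  inp_toFun x k :=
    (g.inp_toFun _ _).trans (congrArg u (tensor_inp A B x
      ⟨f.amalg x.fst (finSigmaFinEquiv.symm k).1, g.amalg _ (finSigmaFinEquiv.symm k).2⟩).symm)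

/-- The associativity morphism `α : A ⊗ (B ⊗ C) → (A ⊗ B) ⊗ C`,
`⟨a, ⟨b_i, c_ij⟩_j⟩_i ↦ ⟨⟨a, b_i⟩_i, c_ij⟩_(i,j)`; its amalgamation is the canonical bijection of
positions. -/
def assoc (A B C : Signature O) :
    SigHom (fun x : O => x) (tensor A (tensor B C)) (tensor (tensor A B) C) where
  toFun x :=
    { fst :=
        { fst := x.fst
          snd := fun i => (x.snd i).fst
          compat := x.compat }
      snd := fun k =>
        (x.snd (finSigmaFinEquiv.symm k).1).snd (finSigmaFinEquiv.symm k).2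
      compat := fun k =>
        (x.snd (finSigmaFinEquiv.symm k).1).compat (finSigmaFinEquiv.symm k).2 }
  amalg x :=
    finSigmaFinEquiv.symm.trans
      ((Equiv.sigmaCongr (β₂ := fun p : (i : Fin (A.arity x.fst)) × Fin (B.arity (x.snd i).fst) =>
            Fin (C.arity ((x.snd p.1).snd p.2)))
          finSigmaFinEquiv.symm (fun _ => Equiv.refl _)).trans
        ((Equiv.sigmaAssoc (fun (i : Fin (A.arity x.fst)) (j : Fin (B.arity (x.snd i).fst)) =>
            Fin (C.arity ((x.snd i).snd j)))).trans
          ((Equiv.sigmaCongrRight (fun _ => finSigmaFinEquiv)).trans finSigmaFinEquiv)))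
  out_toFun _ := rfl
  inp_toFun x k :=
    ((tensor_inp A (tensor B C) x ⟨(finSigmaFinEquiv.symm (finSigmaFinEquiv.symm k).1).1,
        finSigmaFinEquiv ⟨(finSigmaFinEquiv.symm (finSigmaFinEquiv.symm k).1).2,
          (finSigmaFinEquiv.symm k).2⟩⟩).trans
      (tensor_inp B C (x.snd (finSigmaFinEquiv.symm (finSigmaFinEquiv.symm k).1).1)
        ⟨(finSigmaFinEquiv.symm (finSigmaFinEquiv.symm k).1).2,
          (finSigmaFinEquiv.symm k).2⟩)).symm

/-- The left unit morphism `λ : A → I ⊗ A`, `a ↦ ⟨∂_a(0), a⟩`. -/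
def leftUnit (A : Signature O) : SigHom (fun x : O => x) A (tensor (unit O) A) where
  toFun a := { fst := A.out a, snd := fun _ => a, compat := fun _ => rfl }
  amalg a := finSigmaFinEquiv.symm.trans
    ((Equiv.sigmaEquivProd (Fin 1) (Fin (A.arity a))).trans (Equiv.uniqueProd _ _))
  out_toFun _ := rfl
  inp_toFun _ _ := rfl

/-- The right unit morphism `ρ : A ⊗ I → A`, `⟨a, x_i⟩_i ↦ a`. -/
def rightUnit (A : Signature O) : SigHom (fun x : O => x) (tensor A (unit O)) A where
  toFun x := x.fst
  amalg x := (Equiv.sigmaUnique (Fin (A.arity x.fst)) (fun _ => Fin 1)).symm.trans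
    finSigmaFinEquiv
  out_toFun _ := rfl
  inp_toFun x j :=
    (x.compat j).trans (tensor_inp A (unit O) x ⟨j, (0 : Fin 1)⟩).symm

/-- The morphism `I_O → I_Q` of unit signatures over `u : O → Q`. -/
def unitHom (u : O → Q) : SigHom u (unit O) (unit Q) where
  toFun x := u x
  amalg _ := Equiv.refl _
  out_toFun _ := rfl
  inp_toFun _ _ := rfl

theorem tensorHom_id (A B : Signature O) :
    tensorHom (SigHom.id A) (SigHom.id B) = SigHom.id (tensor A B) :=
  SigHom.ext_amalg (fun _ => rfl) fun _ k =>
    congrArg (fun j => (j : Fin _).val) (Equiv.apply_symm_apply finSigmaFinEquiv k)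

theorem tensorHom_comp {u : O → Q} {v : Q → R} {A B : Signature O} {A' B' : Signature Q}
    {A'' B'' : Signature R} (f : SigHom u A A') (f' : SigHom v A' A'')
    (g : SigHom u B B') (g' : SigHom v B' B'') :
    tensorHom (f.comp f') (g.comp g') = (tensorHom f g).comp (tensorHom f' g') :=
  SigHom.ext_amalg (fun _ => rfl) fun x k => by
    refine congrArg (fun e => (Equiv.symm e k).val) (?_ :
      (tensorHom (f.comp f') (g.comp g')).amalg x =
        ((tensorHom f g).comp (tensorHom f' g')).amalg x)
    refine Equiv.ext fun l => ?_
    let p : (j : Fin (A'.arity (f.toFun x.fst))) ×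
        Fin (B'.arity (g.toFun (x.snd (f.amalg x.fst j)))) :=
      ⟨f'.amalg _ (finSigmaFinEquiv.symm l).1, g'.amalg _ (finSigmaFinEquiv.symm l).2⟩
    exact congrArg
      (fun q : (j : Fin (A'.arity (f.toFun x.fst))) ×
          Fin (B'.arity (g.toFun (x.snd (f.amalg x.fst j)))) =>
        finSigmaFinEquiv (n := fun i => B.arity (x.snd i)) ⟨f.amalg _ q.1, g.amalg _ q.2⟩)
      (Equiv.symm_apply_apply finSigmaFinEquiv p).symm

end Signature

/-! ## Multicategories with non-standard amalgamation -/

/-- A (1-level) multicategory with non-standard amalgamation: a monoid, for the total tensor, in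
the fibre over a set `obj` of types of the fibration of amalgamated signatures. -/
structure AmalgMulticat where
  obj : Type u
  sig : Signature obj
  mul : SigHom (fun x => x) (Signature.tensor sig sig) sig
  one : SigHom (fun x => x) (Signature.unit obj) sig
  mul_assoc :
    ((Signature.assoc sig sig sig).comp (Signature.tensorHom mul (SigHom.id sig))).comp mul =
      (Signature.tensorHom (SigHom.id sig) mul).comp mul
  one_mul :
    ((Signature.leftUnit sig).comp (Signature.tensorHom one (SigHom.id sig))).comp mul =
      SigHom.id sig
  mul_one :
    (Signature.tensorHom (SigHom.id sig) one).comp mul = Signature.rightUnit sig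

namespace AmalgMulticat

/-- A morphism of multicategories with non-standard amalgamation over a function `base` between the
sets of types: a morphism of signatures over `base` commuting with multiplications and units. -/
@[ext]
structure Hom (M N : AmalgMulticat.{u}) where
  base : M.obj → N.obj
  hom : SigHom base M.sig N.sig
  mul_hom : M.mul.comp hom = (Signature.tensorHom hom hom).comp N.mul
  one_hom : M.one.comp hom = (Signature.unitHom base).comp N.one

instance : Category.{u} AmalgMulticat.{u} where
  Hom := Hom
  id M :=
    { base := fun x => x
      hom := SigHom.id M.sig
      mul_hom := by rw [Signature.tensorHom_id]; rfl
      one_hom := rfl }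
  comp {M N P} f g :=
    { base := fun x => g.base (f.base x)
      hom := f.hom.comp g.hom
      mul_hom := by
        rw [Signature.tensorHom_comp]
        change (M.mul.comp f.hom).comp g.hom =
          (Signature.tensorHom f.hom f.hom).comp ((Signature.tensorHom g.hom g.hom).comp P.mul)
        rw [f.mul_hom, ← g.mul_hom]
        rfl
      one_hom := by
        change (M.one.comp f.hom).comp g.hom =
          (Signature.unitHom f.base).comp ((Signature.unitHom g.base).comp P.one)
        rw [f.one_hom, ← g.one_hom]
        rfl }
  id_comp _ := rfl
  comp_id _ := rfl
  assoc _ _ _ := rfl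

/-- The projection of multicategories with non-standard amalgamation to their sets of types. -/
def proj : AmalgMulticat.{u} ⥤ Type u where
  obj M := M.obj
  map f := TypeCat.ofHom f.base

end AmalgMulticat

/-! ## Cartesian monads on slices of `Set` -/

namespace SliceMonad

/-- The projection `u^* Y → Y`, i.e. the first projection of the chosen pullback. -/
noncomputable abbrev proj {O Q : Type u} (u : O ⟶ Q) (Y : Over Q) :
    ((Over.pullback u).obj Y).left ⟶ Y.left :=
  pullback.fst Y.hom u

theorem hom_ext_proj {O Q : Type u} {u : O ⟶ Q} {X : Over O} {Y : Over Q}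
    {f g : X ⟶ (Over.pullback u).obj Y} (h : f.left ≫ proj u Y = g.left ≫ proj u Y) : f = g := by
  ext1
  refine pullback.hom_ext h ?_
  exact (Over.w f).trans (Over.w g).symm

theorem map_proj {O Q : Type u} (u : O ⟶ Q) {X Y : Over Q} (f : X ⟶ Y) :
    ((Over.pullback u).map f).left ≫ proj u Y = proj u X ≫ f.left :=
  pullback.lift_fst _ _ _

theorem pullbackComp_hom_proj {O Q R : Type u} (u : O ⟶ Q) (v : Q ⟶ R) (Y : Over R) :
    ((Over.pullbackComp u v).hom.app Y).left ≫ proj u ((Over.pullback v).obj Y) ≫ proj v Y =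
      proj (u ≫ v) Y := by
  have h := conjugateEquiv_counit (Over.mapPullbackAdj (u ≫ v))
    ((Over.mapPullbackAdj u).comp (Over.mapPullbackAdj v)) (Over.mapComp u v).inv Y
  have h' := congrArg CommaMorphism.left h
  simpa [proj, Over.pullbackComp] using h'

theorem pullbackComp_inv_proj {O Q R : Type u} (u : O ⟶ Q) (v : Q ⟶ R) (Y : Over R) :
    ((Over.pullbackComp u v).inv.app Y).left ≫ proj (u ≫ v) Y =
      proj u ((Over.pullback v).obj Y) ≫ proj v Y := by
  rw [← pullbackComp_hom_proj, ← Category.assoc, ← Over.comp_left, Iso.inv_hom_id_app]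
  simp

theorem hom_ext_proj_proj {O Q R : Type u} {u : O ⟶ Q} {v : Q ⟶ R} {X : Over O} {Y : Over R}
    {f g : X ⟶ (Over.pullback u).obj ((Over.pullback v).obj Y)}
    (h : f.left ≫ proj u ((Over.pullback v).obj Y) ≫ proj v Y =
      g.left ≫ proj u ((Over.pullback v).obj Y) ≫ proj v Y) : f = g := by
  rw [← cancel_mono ((Over.pullbackComp u v).inv.app Y)]
  refine hom_ext_proj ?_
  rw [Over.comp_left, Over.comp_left, Category.assoc, Category.assoc, pullbackComp_inv_proj, h]

theorem pullbackId_hom {O : Type u} (Y : Over O) :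
    ((Over.pullbackId (X := O)).hom.app Y).left = proj (𝟙 O) Y := by
  simp [proj, Over.pullbackId]

theorem eqToHom_proj {O Q : Type u} {u v : O ⟶ Q} (h : u = v) (Y : Over Q)
    (h' : (Over.pullback u).obj Y = (Over.pullback v).obj Y) :
    (eqToHom h').left ≫ proj v Y = proj u Y := by
  subst h
  simp

theorem trans_hext {O Q : Type u} {u v : O ⟶ Q} {S : Over O ⥤ Over O} {T : Over Q ⥤ Over Q}
    {ξ : Over.pullback u ⋙ S ⟶ T ⋙ Over.pullback u}
    {ζ : Over.pullback v ⋙ S ⟶ T ⋙ Over.pullback v} (h : u = v)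
    (h' : ∀ (X : Over Q) (e : (Over.pullback u).obj X = (Over.pullback v).obj X),
      (ξ.app X).left ≫ proj u (T.obj X) =
        (S.map (eqToHom e)).left ≫ (ζ.app X).left ≫ proj v (T.obj X)) :
    HEq ξ ζ := by
  subst h
  refine heq_of_eq (NatTrans.ext (funext fun X => hom_ext_proj ?_))
  simpa using h' X rfl

/-- The canonical isomorphism `S (id)^* ≅ S ≅ (id)^* S`. -/
noncomputable def idTrans {O : Type u} (S : Over O ⥤ Over O) :
    Over.pullback (𝟙 O) ⋙ S ⟶ S ⋙ Over.pullback (𝟙 O) :=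
  Functor.whiskerRight Over.pullbackId.hom S ≫ Functor.whiskerLeft S Over.pullbackId.inv

/-- The composite of `ξ : S u^* ⟶ u^* T` and `ζ : T v^* ⟶ v^* W`, that is
`S (v u)^* ≅ S u^* v^* ⟶ u^* T v^* ⟶ u^* v^* W ≅ (v u)^* W`. -/
noncomputable def compTrans {O Q R : Type u} {u : O ⟶ Q} {v : Q ⟶ R}
    {S : Over O ⥤ Over O} {T : Over Q ⥤ Over Q} {W : Over R ⥤ Over R}
    (ξ : Over.pullback u ⋙ S ⟶ T ⋙ Over.pullback u)
    (ζ : Over.pullback v ⋙ T ⟶ W ⋙ Over.pullback v) :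
    Over.pullback (u ≫ v) ⋙ S ⟶ W ⋙ Over.pullback (u ≫ v) :=
  Functor.whiskerRight (Over.pullbackComp u v).hom S ≫
    (Functor.whiskerLeft (Over.pullback v) ξ ≫ Functor.whiskerRight ζ (Over.pullback u)) ≫
      Functor.whiskerLeft W (Over.pullbackComp u v).inv

theorem idTrans_app {O : Type u} (S : Over O ⥤ Over O) (X : Over O) :
    (idTrans S).app X = S.map (Over.pullbackId.hom.app X) ≫ Over.pullbackId.inv.app (S.obj X) :=
  rfl

theorem compTrans_app {O Q R : Type u} {u : O ⟶ Q} {v : Q ⟶ R}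
    {S : Over O ⥤ Over O} {T : Over Q ⥤ Over Q} {W : Over R ⥤ Over R}
    (ξ : Over.pullback u ⋙ S ⟶ T ⋙ Over.pullback u)
    (ζ : Over.pullback v ⋙ T ⟶ W ⋙ Over.pullback v) (X : Over R) :
    (compTrans ξ ζ).app X = S.map ((Over.pullbackComp u v).hom.app X) ≫
      ξ.app ((Over.pullback v).obj X) ≫ (Over.pullback u).map (ζ.app X) ≫
        (Over.pullbackComp u v).inv.app (W.obj X) := by
  simp [compTrans]

theorem idTrans_proj {O : Type u} (S : Over O ⥤ Over O) (X : Over O) :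
    ((idTrans S).app X).left ≫ proj (𝟙 O) (S.obj X) =
      (S.map (Over.pullbackId.hom.app X)).left := by
  rw [idTrans_app, ← pullbackId_hom (S.obj X), Over.comp_left, Category.assoc,
    ← Over.comp_left, Iso.inv_hom_id_app]
  simp

theorem compTrans_proj {O Q R : Type u} {u : O ⟶ Q} {v : Q ⟶ R}
    {S : Over O ⥤ Over O} {T : Over Q ⥤ Over Q} {W : Over R ⥤ Over R}
    (ξ : Over.pullback u ⋙ S ⟶ T ⋙ Over.pullback u)
    (ζ : Over.pullback v ⋙ T ⟶ W ⋙ Over.pullback v) (X : Over R) :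
    ((compTrans ξ ζ).app X).left ≫ proj (u ≫ v) (W.obj X) =
      (S.map ((Over.pullbackComp u v).hom.app X)).left ≫
        (ξ.app ((Over.pullback v).obj X)).left ≫
          proj u (T.obj ((Over.pullback v).obj X)) ≫ (ζ.app X).left ≫ proj v (W.obj X) := by
  have h := map_proj u (ζ.app X)
  dsimp only [Functor.comp_obj] at h
  rw [compTrans_app]
  simp only [Over.comp_left, Category.assoc]
  rw [pullbackComp_inv_proj, reassoc_of% h]

theorem idTrans_comp {O Q : Type u} {u : O ⟶ Q}
    {S : Over O ⥤ Over O} {T : Over Q ⥤ Over Q}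
    (ξ : Over.pullback u ⋙ S ⟶ T ⋙ Over.pullback u) :
    HEq (compTrans (idTrans S) ξ) ξ := by
  refine trans_hext (Category.id_comp u) fun X e => ?_
  have h : (Over.pullbackComp (𝟙 O) u).hom.app X ≫
      Over.pullbackId.hom.app ((Over.pullback u).obj X) = eqToHom e :=
    hom_ext_proj (by
      rw [Over.comp_left, Category.assoc, pullbackId_hom,
        eqToHom_proj (Category.id_comp u), pullbackComp_hom_proj])
  rw [compTrans_proj, reassoc_of% idTrans_proj, ← h, S.map_comp, Over.comp_left, Category.assoc]

theorem comp_idTrans {O Q : Type u} {u : O ⟶ Q}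
    {S : Over O ⥤ Over O} {T : Over Q ⥤ Over Q}
    (ξ : Over.pullback u ⋙ S ⟶ T ⋙ Over.pullback u) :
    HEq (compTrans ξ (idTrans T)) ξ := by
  refine trans_hext (Category.comp_id u) fun X e => ?_
  have h : (Over.pullbackComp u (𝟙 Q)).hom.app X ≫
      (Over.pullback u).map (Over.pullbackId.hom.app X) = eqToHom e :=
    hom_ext_proj (by
      rw [Over.comp_left, Category.assoc, map_proj, pullbackId_hom]
      exact (pullbackComp_hom_proj u (𝟙 Q) X).trans
        (eqToHom_proj (Category.comp_id u) X e).symm)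
  have h₂ := congrArg Over.Hom.left (ξ.naturality (Over.pullbackId.hom.app X))
  have h₃ := map_proj u (T.map (Over.pullbackId.hom.app X))
  rw [Over.comp_left, Over.comp_left] at h₂
  dsimp only [Functor.comp_obj, Functor.comp_map, Functor.id_obj] at h₂ h₃
  rw [compTrans_proj, idTrans_proj, ← h, S.map_comp, Over.comp_left, Category.assoc, ← h₃,
    reassoc_of% h₂]

theorem compTrans_assoc {O Q R P : Type u} {u : O ⟶ Q} {v : Q ⟶ R} {w : R ⟶ P}
    {S : Over O ⥤ Over O} {T : Over Q ⥤ Over Q} {W : Over R ⥤ Over R} {V : Over P ⥤ Over P}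
    (ξ : Over.pullback u ⋙ S ⟶ T ⋙ Over.pullback u)
    (ζ : Over.pullback v ⋙ T ⟶ W ⋙ Over.pullback v)
    (κ : Over.pullback w ⋙ W ⟶ V ⋙ Over.pullback w) :
    HEq (compTrans (compTrans ξ ζ) κ) (compTrans ξ (compTrans ζ κ)) := by
  refine trans_hext (Category.assoc u v w) fun X e => ?_
  have h : (Over.pullbackComp (u ≫ v) w).hom.app X ≫
      (Over.pullbackComp u v).hom.app ((Over.pullback w).obj X) =
      eqToHom e ≫ (Over.pullbackComp u (v ≫ w)).hom.app X ≫
        (Over.pullback u).map ((Over.pullbackComp v w).hom.app X) := by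
    have h₁ := map_proj u ((Over.pullbackComp v w).hom.app X)
    dsimp only [Functor.comp_obj] at h₁
    rw [← cancel_mono ((Over.pullbackComp u v).inv.app ((Over.pullback w).obj X))]
    refine hom_ext_proj_proj ?_
    simp only [Over.comp_left, Category.assoc, reassoc_of% pullbackComp_inv_proj,
      reassoc_of% pullbackComp_hom_proj, reassoc_of% h₁]
    rw [pullbackComp_hom_proj (u ≫ v) w X, pullbackComp_hom_proj v w X,
      pullbackComp_hom_proj u (v ≫ w) X]
    exact (eqToHom_proj (Category.assoc u v w) X e).symm
  have h' := congrArg (fun k => (S.map k).left) h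
  have h₂ := congrArg Over.Hom.left (ξ.naturality ((Over.pullbackComp v w).hom.app X))
  have h₃ := map_proj u (T.map ((Over.pullbackComp v w).hom.app X))
  simp only [S.map_comp, Over.comp_left] at h'
  rw [Over.comp_left, Over.comp_left] at h₂
  dsimp only [Functor.comp_obj, Functor.comp_map] at h' h₂ h₃
  rw [compTrans_proj, compTrans_proj, compTrans_proj, reassoc_of% compTrans_proj, ← reassoc_of% h₃,
    ← reassoc_of% h₂, reassoc_of% h']

theorem equifibered_compTrans {O Q R : Type u} {u : O ⟶ Q} {v : Q ⟶ R}
    {S : Over O ⥤ Over O} {T : Over Q ⥤ Over Q} {W : Over R ⥤ Over R}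
    {ξ : Over.pullback u ⋙ S ⟶ T ⋙ Over.pullback u}
    {ζ : Over.pullback v ⋙ T ⟶ W ⋙ Over.pullback v}
    (hξ : NatTrans.Equifibered ξ) (hζ : NatTrans.Equifibered ζ) :
    NatTrans.Equifibered (compTrans ξ ζ) :=
  have : PreservesLimits (Over.pullback u) := (Over.mapPullbackAdj u).rightAdjoint_preservesLimits
  (NatTrans.Equifibered.of_isIso _).comp (((hξ.whiskerLeft _).comp
    (hζ.whiskerRight (Over.pullback u))).comp (NatTrans.Equifibered.of_isIso _))

end SliceMonad

/-- A cartesian monad: the functor part preserves pullbacks, and the naturality squares of the unit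
and of the multiplication are pullbacks. -/
structure IsCartesianMonad {C : Type*} [Category* C] (T : Monad C) : Prop where
  preservesPullbacks : PreservesLimitsOfShape WalkingCospan T.toFunctor
  unit_cartesian : NatTrans.Equifibered T.η
  mul_cartesian : NatTrans.Equifibered T.μ

/-- A finitary cartesian monad on a slice `Set/O` whose functor part preserves wide pullbacks. -/
structure SliceMonad where
  obj : Type u
  monad : Monad (Over obj)
  cartesian : IsCartesianMonad monad
  finitary : PreservesFilteredColimits monad.toFunctor
  preservesWidePullbacks :
    ∀ J : Type u, PreservesLimitsOfShape (WidePullbackShape J) monad.toFunctor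

namespace SliceMonad

/-- A morphism `S → T` over `u : O → Q`, between monads `S` on `Set/O` and `T` on `Set/Q`: a
cartesian morphism of monads whose functor part is the pullback functor `u^* : Set/Q ⥤ Set/O`, i.e.
a cartesian natural transformation `ξ : S u^* ⟶ u^* T` compatible with units and
multiplications. -/
@[ext]
structure Hom (S T : SliceMonad.{u}) where
  base : S.obj ⟶ T.obj
  trans : Over.pullback base ⋙ S.monad.toFunctor ⟶ T.monad.toFunctor ⋙ Over.pullback base
  cartesian : NatTrans.Equifibered trans
  unit_trans : ∀ X : Over T.obj,
    S.monad.η.app ((Over.pullback base).obj X) ≫ trans.app X =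
      (Over.pullback base).map (T.monad.η.app X)
  mul_trans : ∀ X : Over T.obj,
    S.monad.μ.app ((Over.pullback base).obj X) ≫ trans.app X =
      S.monad.map (trans.app X) ≫ trans.app (T.monad.obj X) ≫
        (Over.pullback base).map (T.monad.μ.app X)

/-- The identity morphism. -/
noncomputable def Hom.id (S : SliceMonad.{u}) : Hom S S where
  base := 𝟙 S.obj
  trans := idTrans S.monad.toFunctor
  cartesian := (NatTrans.Equifibered.of_isIso _).comp (NatTrans.Equifibered.of_isIso _)
  unit_trans X := by
    rw [← cancel_mono (Over.pullbackId.hom.app _), idTrans_app]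
    simpa using (S.monad.η.naturality (Over.pullbackId.hom.app X)).symm
  mul_trans X := by
    rw [← cancel_mono (Over.pullbackId.hom.app _), idTrans_app, idTrans_app]
    simpa using (S.monad.μ.naturality (Over.pullbackId.hom.app X)).symm

/-- Composition of morphisms: pullback functors are composed up to the canonical isomorphism
`u^* v^* ≅ (v u)^*`. -/
noncomputable def Hom.comp {S T W : SliceMonad.{u}} (f : Hom S T) (g : Hom T W) : Hom S W where
  base := f.base ≫ g.base
  trans := compTrans f.trans g.trans
  cartesian := equifibered_compTrans f.cartesian g.cartesian
  unit_trans X := by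
    have h := S.monad.η.naturality ((Over.pullbackComp f.base g.base).hom.app X)
    have h₂ := f.unit_trans ((Over.pullback g.base).obj X)
    have h₃ := congrArg (Over.pullback f.base).map (g.unit_trans X)
    have h₄ := (Over.pullbackComp f.base g.base).hom.naturality (W.monad.η.app X)
    rw [← cancel_mono ((Over.pullbackComp f.base g.base).hom.app _), compTrans_app]
    simp only [Functor.comp_obj, Functor.comp_map, Functor.id_obj, Functor.id_map,
      Functor.map_comp] at h h₂ h₃ h₄
    simp only [Category.assoc, Iso.inv_hom_id_app, Functor.comp_obj, Category.comp_id]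
    rw [← reassoc_of% h, reassoc_of% h₂, h₃]
    exact h₄.symm
  mul_trans X := by
    have h := S.monad.μ.naturality ((Over.pullbackComp f.base g.base).hom.app X)
    have h₂ := f.mul_trans ((Over.pullback g.base).obj X)
    have h₃ := f.trans.naturality (g.trans.app X)
    have h₄ := congrArg (Over.pullback f.base).map (g.mul_trans X)
    have h₅ := (Over.pullbackComp f.base g.base).hom.naturality (W.monad.μ.app X)
    rw [← cancel_mono ((Over.pullbackComp f.base g.base).hom.app _), compTrans_app, compTrans_app]
    simp only [Functor.comp_obj, Functor.comp_map, Functor.map_comp] at h h₂ h₃ h₄ h₅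
    simp only [Category.assoc, Iso.inv_hom_id_app, Functor.comp_obj, Category.comp_id,
      Functor.map_comp, h₅, Iso.inv_hom_id_app_assoc]
    rw [← reassoc_of% h, reassoc_of% h₂, h₄, ← reassoc_of% h₃]
    simp only [← Functor.map_comp_assoc, Iso.inv_hom_id_app]
    simp

noncomputable instance : Category SliceMonad.{u} where
  Hom := Hom
  id := Hom.id
  comp := Hom.comp
  id_comp f := Hom.ext (Category.id_comp f.base) (idTrans_comp f.trans)
  comp_id f := Hom.ext (Category.comp_id f.base) (comp_idTrans f.trans)
  assoc f g k := Hom.ext (Category.assoc f.base g.base k.base) (compTrans_assoc f.trans g.trans k.trans)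

/-- The projection of monads on slices `Set/O` to the sets `O`. -/
noncomputable def toBase : SliceMonad.{u} ⥤ Type u where
  obj S := S.obj
  map f := f.base

end SliceMonad

/-! ## Equivalences of fibrations over a fixed base -/

/-- An equivalence between `p : 𝒳 ⥤ 𝒮` and `q : 𝒴 ⥤ 𝒮` over `𝒮`: an equivalence of categories whose
two functors commute strictly with the projections and preserve prone (strongly cartesian)
morphisms, and whose unit and counit are vertical. -/
structure FibredEquivalence {𝒮 𝒳 𝒴 : Type*} [Category* 𝒮] [Category* 𝒳] [Category* 𝒴]
    (p : 𝒳 ⥤ 𝒮) (q : 𝒴 ⥤ 𝒮) where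
  equiv : 𝒳 ≌ 𝒴
  functor_comp : equiv.functor ⋙ q = p
  inverse_comp : equiv.inverse ⋙ p = q
  unit_vertical : ∀ x : 𝒳, p.IsHomLift (𝟙 (p.obj x)) (equiv.unitIso.hom.app x)
  counit_vertical : ∀ y : 𝒴, q.IsHomLift (𝟙 (q.obj y)) (equiv.counitIso.hom.app y)
  functor_prone : ∀ {R S : 𝒮} (f : R ⟶ S) {x x' : 𝒳} (φ : x ⟶ x'),
    p.IsStronglyCartesian f φ → q.IsStronglyCartesian f (equiv.functor.map φ)
  inverse_prone : ∀ {R S : 𝒮} (f : R ⟶ S) {y y' : 𝒴} (ψ : y ⟶ y'),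
    q.IsStronglyCartesian f ψ → p.IsStronglyCartesian f (equiv.inverse.map ψ)

/-!
A signature `A` over `O` has a polynomial endofunctor `Signature.poly A` of `Set/O`: its value at a
family `X` consists of the operations of `A` with an argument in `X`, of the right type, at each
input position (`Signature.Eval`). The theorem says that this construction identifies signatures
with the finitary endofunctors of slices of `Set` that preserve wide pullbacks, compatibly with
composition and with change of the set of types.

*Tensor and composition.* The polynomial functor of `A ⊗ B` is the composite of those of `B` and `A`
(`Eval.nestEquiv`), that of the unit signature is the identity (`Eval.unitEquiv`), and the
coherence morphisms of the tensor become identities (`Eval.trans_assoc`, `Eval.trans_rightUnit`,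
and by definition for the left unit). A morphism of signatures is determined by its action on values
(`Eval.sigHom_ext`), so the axioms of a monoid of signatures are equivalent to the axioms of a monad
on its polynomial functor (`Eval.mul_assoc_iff`, `Eval.one_mul_iff`, `Eval.mul_one_iff`).

*Morphisms.* Every element of `Eval A` with operation `a` is the image, under a unique map, of a
generic element whose family of arguments is the family of inputs of `a`. Hence a transformation
out of a polynomial functor is given by the images of the generic elements, and it is cartesian
exactly when these images are again generic, that is when their arguments enumerate the inputs of
`a` bijectively. This bijection is an amalgamation permutation, so cartesian transformations are
morphisms of signatures (`Eval.exists_sigHom`). Over a map `u` of sets of types one reduces to this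
case by changing the types of the source along `u` (`Signature.exists_pullbackTrans_eq`). So the
functor from multicategories to monads is full and faithful.

*Objects.* Let `T` be finitary and preserve wide pullbacks, and let `t` be an element of its value at
the terminal family. The product over the terminal family of all finite families carrying an element
over `t` carries an element mapping to every element over `t`
(`SliceMonad.exists_weaklyInitial`). Restricted to a finite support of minimal cardinality, this
element becomes initial: two maps agreeing on it have an equalizer which also supports it, hence
they are equal (`SliceMonad.exists_isGeneric`). The generic elements obtained in this way are the
operations of a signature whose polynomial functor is isomorphic to `T`, and the isomorphism carries
the monad structure of `T` to a monoid structure on the signature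
(`SliceMonad.exists_iso_toSliceMonad`).

*Fibrations.* Signatures, and with them multicategories, restrict along a map of sets of types
(`AmalgMulticat.isFibered_proj`). A fully faithful functor over a base that is essentially
surjective up to vertical isomorphisms is an equivalence over the base
(`FibredEquivalence.ofFullyFaithful`), and the fibration property is carried along it
(`FibredEquivalence.isFibered_of_comp`).
-/

universe w w'

/-! ### The polynomial functor of a signature, on families of sets -/

namespace Signature

variable {O Q R : Type u}

/-- The value of the polynomial functor of a signature `A` at a family `p : X → O`, seen as a set
`X` of elements with types in `O`: an operation of `A` together with an argument of the right type
for each of its input positions. -/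
structure Eval (A : Signature O) {X : Type w} (p : X → O) : Type (max u w) where
  op : A.Op
  arg : Fin (A.arity op) → X
  type_arg : ∀ i, p (arg i) = A.inp op i

namespace Eval

variable {A B C : Signature O} {X : Type w} {p : X → O}

theorem ext_arg {e : Eval A p} {x : Fin (A.arity e.op) → X} {h} (hx : ∀ i, e.arg i = x i) :
    e = ⟨e.op, x, h⟩ := by
  obtain ⟨a, y, hy⟩ := e
  obtain rfl : y = x := funext hx
  rfl

theorem arg_eq_of_mk_eq {a : A.Op} {x y : Fin (A.arity a) → X} {hx hy}
    (h : (⟨a, x, hx⟩ : Eval A p) = ⟨a, y, hy⟩) (i) : x i = y i := by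
  simp only [Eval.mk.injEq, heq_eq_eq, true_and] at h
  exact congrFun h i

/-- The type of an element of `Eval A p`. -/
def out (e : Eval A p) : O := A.out e.op

/-- The action of a morphism of signatures over `v` and of a map of families over `v` on the values
of polynomial functors. -/
def map {v : O → Q} {A' : Signature Q} {Y : Type w'} {q : Y → Q} (f : SigHom v A A') (k : X → Y)
    (hk : ∀ x, q (k x) = v (p x)) (e : Eval A p) : Eval A' q where
  op := f.toFun e.op
  arg j := k (e.arg (f.amalg e.op j))
  type_arg j := by rw [hk, e.type_arg, f.inp_toFun]

/-- The functorial action of the polynomial functor of `A` on a map of families. -/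
abbrev lift (A : Signature O) {Y : Type w'} {q : Y → O} (k : X → Y) (hk : ∀ x, q (k x) = p x) :
    Eval A p → Eval A q :=
  map (SigHom.id A) k hk

/-- The component at `p` of the transformation of polynomial functors induced by a morphism of
signatures over the identity. -/
abbrev trans (f : SigHom (fun x => x) A B) : Eval A p → Eval B p :=
  map f (fun x => x) fun _ => rfl

theorem out_map {v : O → Q} {A' : Signature Q} {Y : Type w'} {q : Y → Q} (f : SigHom v A A')
    (k : X → Y) (hk : ∀ x, q (k x) = v (p x)) (e : Eval A p) : (map f k hk e).out = v e.out :=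
  f.out_toFun e.op

/-- The family of the input types of `a`, indexed by a set in the universe of `O`. -/
def inpFamily (A : Signature O) (a : A.Op) (i : ULift.{u} (Fin (A.arity a))) : O := A.inp a i.down

/-- The universal element with operation `a` of the polynomial functor of `A`: every element with
operation `a` is the image of this one under a unique map of families. -/
def generic (A : Signature O) (a : A.Op) : Eval A (inpFamily A a) :=
  ⟨a, fun i => ⟨i⟩, fun _ => rfl⟩

/-- A morphism of signatures is determined by its action on values of polynomial functors. -/
theorem sigHom_ext {v : O → Q} {A' : Signature Q} {f g : SigHom v A A'}
    (h : ∀ a, map (q := fun i => v (inpFamily A a i)) f (fun i => i) (fun _ => rfl) (generic A a) =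
      map g (fun i => i) (fun _ => rfl) (generic A a)) : f = g := by
  obtain ⟨f, σ, _, _⟩ := f
  obtain ⟨g, τ, _, _⟩ := g
  obtain rfl : f = g := funext fun a => congrArg Eval.op (h a)
  obtain rfl : σ = τ := by
    funext a
    exact Equiv.ext fun j => congrArg ULift.down (arg_eq_of_mk_eq (h a) j)
  rfl

theorem trans_ext {f g : SigHom (fun x => x) A B}
    (h : ∀ (X : Type u) (p : X → O) (e : Eval A p), trans f e = trans g e) : f = g :=
  sigHom_ext fun _ => h _ _ _

theorem unit_ext {e e' : Eval (unit O) p} (h : e.arg (0 : Fin 1) = e'.arg (0 : Fin 1)) :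
    e = e' := by
  have key (a b : O) (hab : a = b) (x y : Fin 1 → X) (hx) (hy) (hxy : x 0 = y 0) :
      (⟨a, x, hx⟩ : Eval (unit O) p) = ⟨b, y, hy⟩ := by
    subst hab
    obtain rfl : x = y := funext fun i => by rwa [Subsingleton.elim i 0]
    rfl
  refine key e.op e'.op ?_ e.arg e'.arg e.type_arg e'.type_arg h
  exact (e.type_arg (0 : Fin 1)).symm.trans ((congrArg p h).trans (e'.type_arg (0 : Fin 1)))

/-- The value of the polynomial functor of the unit signature at `p : X → O` is `X`. -/
def unitEquiv (p : X → O) : X ≃ Eval (unit O) p where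
  toFun x := ⟨p x, fun _ => x, fun _ => rfl⟩
  invFun e := e.arg (0 : Fin 1)
  left_inv _ := rfl
  right_inv _ := unit_ext rfl

theorem unitEquiv_map {v : O → Q} {Y : Type w'} {q : Y → Q} (k : X → Y)
    (hk : ∀ x, q (k x) = v (p x)) (x : X) :
    map (unitHom v) k hk (unitEquiv p x) = unitEquiv q (k x) :=
  unit_ext rfl

/-- The polynomial functor of `A ⊗ B` is the composite of those of `B` and of `A`. -/
def nest (e : Eval A (out : Eval B p → O)) : Eval (tensor A B) p where
  op :=
    { fst := e.op
      snd := fun i => (e.arg i).op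
      compat := fun i => (e.type_arg i).symm }
  arg k := (e.arg (finSigmaFinEquiv.symm k).1).arg (finSigmaFinEquiv.symm k).2
  type_arg _ := (e.arg _).type_arg _

theorem nest_arg (e : Eval A (out : Eval B p → O))
    (q : (i : Fin (A.arity e.op)) × Fin (B.arity (e.arg i).op)) :
    e.nest.arg (finSigmaFinEquiv q) = (e.arg q.1).arg q.2 :=
  congrArg (fun r : (i : Fin (A.arity e.op)) × Fin (B.arity (e.arg i).op) =>
    (e.arg r.1).arg r.2) (Equiv.symm_apply_apply finSigmaFinEquiv q)

/-- The decomposition of an element of the polynomial functor of `A ⊗ B` into an operation of `A` and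
elements of the polynomial functor of `B`. It is inverse to `nest`. -/
def unnest (e : Eval (tensor A B) p) : Eval A (out : Eval B p → O) where
  op := e.op.fst
  arg i :=
    { op := e.op.snd i
      arg := fun j => e.arg (finSigmaFinEquiv ⟨i, j⟩)
      type_arg := fun j => (e.type_arg _).trans (tensor_inp A B e.op ⟨i, j⟩) }
  type_arg i := (e.op.compat i).symm

/-- The polynomial functor of `A ⊗ B` is the composite of those of `B` and of `A`. -/
def nestEquiv (A B : Signature O) (p : X → O) :
    Eval A (out : Eval B p → O) ≃ Eval (tensor A B) p where
  toFun := nest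
  invFun := unnest
  left_inv e := by
    refine (ext_arg fun i => ?_).symm
    exact ext_arg fun j => (nest_arg e ⟨i, j⟩).symm
  right_inv e := by
    refine (ext_arg fun k => ?_).symm
    exact congrArg e.arg (Equiv.apply_symm_apply finSigmaFinEquiv k).symm

theorem nest_map {v : O → Q} {A' B' : Signature Q} {Y : Type w'} {q : Y → Q} (f : SigHom v A A')
    (g : SigHom v B B') (k : X → Y) (hk : ∀ x, q (k x) = v (p x))
    (e : Eval A (out : Eval B p → O)) :
    nest (map f (map g k hk) (out_map g k hk) e) = map (tensorHom f g) k hk (nest e) := by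
  symm
  refine ext_arg fun j => ?_
  exact congrArg k (nest_arg e ⟨f.amalg _ (finSigmaFinEquiv.symm j).1, g.amalg _ _⟩)

/-- The associativity of the tensor corresponds to the associativity of composition of polynomial
functors. -/
theorem trans_assoc (e : Eval A (out : Eval B (out : Eval C p → O) → O)) :
    trans (assoc A B C) (nest (lift A nest (fun _ => rfl) e)) = nest (nest e) := by
  refine ext_arg fun k => ?_
  refine (nest_arg (lift A nest (fun _ => rfl) e) ⟨(finSigmaFinEquiv.symm
    (finSigmaFinEquiv.symm k).1).1, finSigmaFinEquiv ⟨(finSigmaFinEquiv.symm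
    (finSigmaFinEquiv.symm k).1).2, (finSigmaFinEquiv.symm k).2⟩⟩).trans ?_
  exact nest_arg (e.arg _) ⟨_, _⟩

theorem trans_rightUnit (e : Eval A p) :
    trans (rightUnit A) (nest (lift A (unitEquiv p) (fun _ => rfl) e)) = e :=
  ext_arg fun i => nest_arg (lift A (unitEquiv p) (fun _ => rfl) e) ⟨i, (0 : Fin 1)⟩

/-! ### Monoids of signatures act as monads -/

/-- The multiplication of polynomial functors induced by `m : A ⊗ A → A`. -/
def mul (m : SigHom (fun x => x) (tensor A A) A) (e : Eval A (out : Eval A p → O)) : Eval A p :=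
  trans m (nest e)

/-- The unit of polynomial functors induced by `i : I → A`. -/
def one (i : SigHom (fun x => x) (unit O) A) (p : X → O) (x : X) : Eval A p :=
  trans i (unitEquiv p x)

theorem out_mul (m : SigHom (fun x => x) (tensor A A) A) (e : Eval A (out : Eval A p → O)) :
    (mul m e).out = e.out :=
  out_map m _ (fun _ => rfl) (nest e)

theorem out_one (i : SigHom (fun x => x) (unit O) A) (p : X → O) (x : X) :
    (one i p x).out = p x :=
  out_map i _ (fun _ => rfl) (unitEquiv p x)

theorem map_mul {v : O → Q} {A' : Signature Q} {Y : Type w'} {q : Y → Q}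
    {m : SigHom (fun x => x) (tensor A A) A} {m' : SigHom (fun x => x) (tensor A' A') A'}
    {f : SigHom v A A'} (h : m.comp f = (tensorHom f f).comp m') (k : X → Y)
    (hk : ∀ x, q (k x) = v (p x)) (e : Eval A (out : Eval A p → O)) :
    map f k hk (mul m e) = mul m' (map f (map f k hk) (out_map f k hk) e) := by
  unfold mul
  rw [nest_map]
  exact congrArg (fun g : SigHom v (tensor A A) A' => map g k hk (nest e)) h

theorem map_one {v : O → Q} {A' : Signature Q} {Y : Type w'} {q : Y → Q}
    {i : SigHom (fun x => x) (unit O) A} {i' : SigHom (fun x => x) (unit Q) A'}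
    {f : SigHom v A A'} (h : i.comp f = (unitHom v).comp i') (k : X → Y)
    (hk : ∀ x, q (k x) = v (p x)) (x : X) :
    map f k hk (one i p x) = one i' q (k x) := by
  unfold one
  rw [← unitEquiv_map k hk]
  exact congrArg (fun g : SigHom v (unit O) A' => map g k hk (unitEquiv p x)) h

variable {m : SigHom (fun x => x) (tensor A A) A} {i : SigHom (fun x => x) (unit O) A}

theorem trans_assoc_mul (m : SigHom (fun x => x) (tensor A A) A)
    (e : Eval A (out : Eval A (out : Eval A p → O) → O)) :
    trans (((assoc A A A).comp (tensorHom m (SigHom.id A))).comp m)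
      (nest (lift A nest (fun _ => rfl) e)) = mul m (mul m e) := by
  change trans m (trans (tensorHom m (SigHom.id A))
    (trans (assoc A A A) (nest (lift A nest (fun _ => rfl) e)))) = _
  rw [trans_assoc]
  exact congrArg (trans m) (nest_map m (SigHom.id A) (fun x => x) (fun _ => rfl) (nest e)).symm

theorem trans_mul_mul (m : SigHom (fun x => x) (tensor A A) A)
    (e : Eval A (out : Eval A (out : Eval A p → O) → O)) :
    trans ((tensorHom (SigHom.id A) m).comp m) (nest (lift A nest (fun _ => rfl) e)) =
      mul m (lift A (mul m) (out_mul m) e) :=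
  congrArg (trans m) (nest_map (SigHom.id A) m (fun x => x) (fun _ => rfl)
    (lift A nest (fun _ => rfl) e)).symm

theorem trans_one_mul (e : Eval A p) :
    trans (((leftUnit A).comp (tensorHom i (SigHom.id A))).comp m) e = mul m (one i out e) :=
  congrArg (trans m) (nest_map i (SigHom.id A) (fun x => x) (fun _ => rfl) (unitEquiv out e)).symm

theorem trans_mul_one (e : Eval A p) :
    trans ((tensorHom (SigHom.id A) i).comp m) (nest (lift A (unitEquiv p) (fun _ => rfl) e)) =
      mul m (lift A (one i p) (out_one i p) e) :=
  congrArg (trans m) (nest_map (SigHom.id A) i (fun x => x) (fun _ => rfl)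
    (lift A (unitEquiv p) (fun _ => rfl) e)).symm

/-- The associativity of `m` amounts to that of the multiplication of polynomial functors. -/
theorem mul_assoc_iff :
    ((assoc A A A).comp (tensorHom m (SigHom.id A))).comp m =
        (tensorHom (SigHom.id A) m).comp m ↔
      ∀ (X : Type u) (p : X → O) (e : Eval A (out : Eval A (out : Eval A p → O) → O)),
        mul m (mul m e) = mul m (lift A (mul m) (out_mul m) e) := by
  refine ⟨fun h X p e => ?_, fun h => trans_ext fun X p e => ?_⟩
  · rw [← trans_assoc_mul, ← trans_mul_mul]
    exact congrArg (fun g => trans g _) h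
  · obtain ⟨e, rfl⟩ := (nestEquiv A (tensor A A) _).surjective e
    obtain ⟨e, rfl⟩ : ∃ e', lift A nest (fun _ => rfl) e' = e :=
      ⟨lift A unnest (fun _ => rfl) e,
        (ext_arg fun j => ((nestEquiv A A p).apply_symm_apply (e.arg j)).symm).symm⟩
    exact (trans_assoc_mul m e).trans ((h X p e).trans (trans_mul_mul m e).symm)

theorem one_mul_iff :
    ((leftUnit A).comp (tensorHom i (SigHom.id A))).comp m = SigHom.id A ↔
      ∀ (X : Type u) (p : X → O) (e : Eval A p), mul m (one i out e) = e := by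
  refine ⟨fun h X p e => ?_, fun h => trans_ext fun X p e => ?_⟩
  · rw [← trans_one_mul]
    exact congrArg (fun g => trans g e) h
  · exact (trans_one_mul e).trans (h X p e)

theorem mul_one_iff :
    (tensorHom (SigHom.id A) i).comp m = rightUnit A ↔
      ∀ (X : Type u) (p : X → O) (e : Eval A p),
        mul m (lift A (one i p) (out_one i p) e) = e := by
  refine ⟨fun h X p e => ?_, fun h => trans_ext fun X p e => ?_⟩
  · rw [← trans_mul_one]
    exact (congrArg (fun g => trans g _) h).trans (trans_rightUnit e)
  · obtain ⟨e, rfl⟩ := (nestEquiv A (unit O) _).surjective e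
    obtain ⟨e, rfl⟩ : ∃ e', lift A (unitEquiv p) (fun _ => rfl) e' = e :=
      ⟨lift A (unitEquiv p).symm
        (fun x => congrArg out ((unitEquiv p).apply_symm_apply x)) e,
        (ext_arg fun j => ((unitEquiv p).apply_symm_apply (e.arg j)).symm).symm⟩
    exact (trans_mul_one e).trans ((h X p e).trans (trans_rightUnit e).symm)

/-! ### Morphisms of signatures are the cartesian transformations -/

/-- A morphism of signatures acts on polynomial functors as a cartesian transformation: a pullback
square of families gives a pullback square of values. -/
theorem existsUnique_map {v : O → Q} {A' : Signature Q} (f : SigHom v A A')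
    {X' Y Y' : Type*} {q : Y → O} {p' : X' → Q} {q' : Y' → Q}
    {g : X → Y} (hg : ∀ x, q (g x) = p x) {g' : X' → Y'} (hg' : ∀ x, q' (g' x) = p' x)
    {k : X → X'} (hk : ∀ x, p' (k x) = v (p x)) {l : Y → Y'} (hl : ∀ y, q' (l y) = v (q y))
    (hpb : ∀ y x', l y = g' x' → ∃ x, g x = y ∧ k x = x')
    (hinj : ∀ x₁ x₂, g x₁ = g x₂ → k x₁ = k x₂ → x₁ = x₂)
    (e : Eval A q) (t : Eval A' p') (h : map f l hl e = lift A' g' hg' t) :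
    ∃! c : Eval A p, lift A g hg c = e ∧ map f k hk c = t := by
  obtain ⟨a, y, hy⟩ := e
  obtain ⟨b, x', hx'⟩ := t
  obtain rfl : f.toFun a = b := congrArg Eval.op h
  have h₁ : ∀ j, l (y (f.amalg a j)) = g' (x' j) := arg_eq_of_mk_eq h
  have h₂ : ∀ i, ∃ x, g x = y i ∧ k x = x' ((f.amalg a).symm i) := fun i =>
    hpb _ _ (by rw [← h₁, Equiv.apply_symm_apply])
  choose x hx₁ hx₂ using h₂
  refine ⟨⟨a, x, fun i => by rw [← hg, hx₁, hy]⟩, ⟨ext_arg hx₁, ext_arg fun j => ?_⟩, ?_⟩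
  · exact (hx₂ _).trans (congrArg x' (Equiv.symm_apply_apply _ j))
  · rintro ⟨a', z, hz⟩ ⟨hz₁, hz₂⟩
    obtain rfl : a' = a := congrArg Eval.op hz₁
    refine ext_arg fun i => hinj _ _ ?_ ?_
    · exact (arg_eq_of_mk_eq hz₁ i).trans (hx₁ i).symm
    · rw [hx₂]
      refine (congrArg (fun i => k (z i)) (Equiv.apply_symm_apply (f.amalg a') i).symm).trans ?_
      exact arg_eq_of_mk_eq hz₂ _

/-- A cartesian transformation of polynomial functors over a fixed set of types comes from a
morphism of signatures. -/
theorem exists_sigHom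
    (θ : ∀ {X : Type u} (p : X → O), Eval A p → Eval B p)
    (hout : ∀ {X : Type u} (p : X → O) (e : Eval A p), (θ p e).out = e.out)
    (hnat : ∀ {X Y : Type u} (p : X → O) (q : Y → O) (k : X → Y) (hk) (e : Eval A p),
      θ q (lift A k hk e) = lift B k hk (θ p e))
    (hcart : ∀ {X Y : Type u} (p : X → O) (q : Y → O) (k : X → Y) (hk) (e : Eval A q)
      (t : Eval B p), θ q e = lift B k hk t → ∃ c, lift A k hk c = e ∧ θ p c = t) :
    ∃ f : SigHom (fun x => x) A B, ∀ {X : Type u} (p : X → O) (e : Eval A p),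
      θ p e = trans f e := by
  have hbij (a : A.Op) : Function.Bijective
      (fun j => ((θ _ (generic A a)).arg j).down) := by
    -- pulling the generic element of `B` back along `θ (generic A a)` gives the inverse
    obtain ⟨⟨a', r, hr⟩, hc, ht⟩ := hcart (inpFamily B (θ _ (generic A a)).op) (inpFamily A a)
      (fun j => (θ _ (generic A a)).arg j.down) (fun j => (θ _ (generic A a)).type_arg j.down)
      (generic A a) (generic B _) rfl
    obtain rfl : a' = a := congrArg Eval.op hc
    have hn := hnat _ (inpFamily B (θ _ (generic A a')).op) (fun i => r i.down)
      (fun i => hr i.down) (generic A a')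
    refine Function.bijective_iff_has_inverse.2
      ⟨fun i => (r i).down, fun j => ?_, fun i => congrArg ULift.down (arg_eq_of_mk_eq hc i)⟩
    exact congrArg ULift.down (arg_eq_of_mk_eq (hn.symm.trans ht) j)
  refine ⟨
    { toFun := fun a => (θ _ (generic A a)).op
      amalg := fun a => Equiv.ofBijective _ (hbij a)
      out_toFun := fun a => hout _ (generic A a)
      inp_toFun := fun a j => ((θ _ (generic A a)).type_arg j).symm }, fun p e => ?_⟩
  exact hnat _ p (fun i => e.arg i.down) (fun i => e.type_arg i.down) (generic A e.op)

end Eval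

end Signature

/-! ### Elements of objects of slices of the category of sets -/

namespace SliceMonad

variable {O Q : Type u}

/-- The morphism of `Set/O` given by a map of sets over `O`. -/
def overHom {X Y : Over O} (f : X.left → Y.left) (h : ∀ x, Y.hom (f x) = X.hom x) : X ⟶ Y :=
  Over.homMk (↾f) (by ext x; exact h x)

theorem hom_left_apply {X Y : Over O} (f : X ⟶ Y) (x : X.left) : Y.hom (f.left x) = X.hom x :=
  ConcreteCategory.congr_hom (Over.w f) x

theorem over_hom_ext {X Y : Over O} {f g : X ⟶ Y} (h : ∀ x, f.left x = g.left x) : f = g :=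
  Over.OverMorphism.ext (ConcreteCategory.hom_ext _ _ h)

theorem left_congr {X Y : Over O} {f g : X ⟶ Y} (h : f = g) (x : X.left) :
    f.left x = g.left x := by
  rw [h]

theorem isPullback_iff {P X Y Z : Over O} {fst : P ⟶ X} {snd : P ⟶ Y} {f : X ⟶ Z} {g : Y ⟶ Z}
    (w : fst ≫ f = snd ≫ g) :
    IsPullback fst snd f g ↔
      ∀ x y, f.left x = g.left y → ∃! z, fst.left z = x ∧ snd.left z = y := by
  have h : IsPullback fst snd f g ↔ IsPullback fst.left snd.left f.left g.left :=
    ⟨fun h => h.map (Over.forget O), fun h => IsPullback.of_map (Over.forget O) w h⟩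
  rw [h, Types.isPullback_iff]
  constructor
  · rintro ⟨-, h₁, h₂⟩ x y hxy
    obtain ⟨z, hz⟩ := h₂ x y hxy
    exact ⟨z, hz, fun z' hz' => h₁ z' z ⟨hz'.1.trans hz.1.symm, hz'.2.trans hz.2.symm⟩⟩
  · intro h
    have hw := congrArg CommaMorphism.left w
    refine ⟨hw, fun z z' hz => ?_, fun x y hxy => (h x y hxy).exists⟩
    exact (h _ _ (ConcreteCategory.congr_hom hw z')).unique hz ⟨rfl, rfl⟩

/-- A transformation of functors into `Set/O` is cartesian if its naturality squares are pullbacks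
on elements. -/
theorem equifibered_iff {C : Type*} [Category* C] {F G : C ⥤ Over O} (θ : F ⟶ G) :
    NatTrans.Equifibered θ ↔ ∀ ⦃X Y : C⦄ (f : X ⟶ Y) (a : (F.obj Y).left) (b : (G.obj X).left),
      (θ.app Y).left a = (G.map f).left b →
        ∃! c, (F.map f).left c = a ∧ (θ.app X).left c = b :=
  forall₃_congr fun _ _ f => isPullback_iff (θ.naturality f)

/-! ### Elements of pullbacks along a map of sets of types -/

theorem proj_hom_apply (u : O ⟶ Q) (Y : Over Q) (z : ((Over.pullback u).obj Y).left) :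
    Y.hom (proj u Y z) = u (((Over.pullback u).obj Y).hom z) :=
  ConcreteCategory.congr_hom (pullback.condition (f := Y.hom) (g := u)) z

theorem pullback_ext {u : O ⟶ Q} {Y : Over Q} {z z' : ((Over.pullback u).obj Y).left}
    (h : proj u Y z = proj u Y z')
    (h' : ((Over.pullback u).obj Y).hom z = ((Over.pullback u).obj Y).hom z') : z = z' :=
  Types.ext_of_isPullback (IsPullback.of_hasPullback Y.hom u) h h'

theorem pullback_exists {u : O ⟶ Q} {Y : Over Q} (y : Y.left) (o : O) (h : Y.hom y = u o) :
    ∃ z : ((Over.pullback u).obj Y).left,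
      proj u Y z = y ∧ ((Over.pullback u).obj Y).hom z = o :=
  Types.exists_of_isPullback (IsPullback.of_hasPullback Y.hom u) y o h

theorem map_proj_apply (u : O ⟶ Q) {X Y : Over Q} (f : X ⟶ Y)
    (z : ((Over.pullback u).obj X).left) :
    proj u Y (((Over.pullback u).map f).left z) = f.left (proj u X z) :=
  ConcreteCategory.congr_hom (map_proj u f) z

/-- The morphism into `u^* Y` given by a map over `u`. -/
noncomputable def pullbackLift {u : O ⟶ Q} {X : Over O} {Y : Over Q} (f : X.left → Y.left)
    (h : ∀ x, Y.hom (f x) = u (X.hom x)) : X ⟶ (Over.pullback u).obj Y :=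
  Over.homMk (pullback.lift (↾f) X.hom (by ext x; exact h x)) (pullback.lift_snd _ _ _)

theorem pullbackLift_proj {u : O ⟶ Q} {X : Over O} {Y : Over Q} (f : X.left → Y.left)
    (h : ∀ x, Y.hom (f x) = u (X.hom x)) (x : X.left) :
    proj u Y ((pullbackLift f h).left x) = f x :=
  ConcreteCategory.congr_hom (pullback.lift_fst (f := Y.hom) (g := u) (↾f) X.hom _) x

theorem hom_ext_proj_apply {u : O ⟶ Q} {X : Over O} {Y : Over Q}
    {f g : X ⟶ (Over.pullback u).obj Y}
    (h : ∀ x, proj u Y (f.left x) = proj u Y (g.left x)) : f = g :=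
  hom_ext_proj (ConcreteCategory.hom_ext _ _ h)

end SliceMonad

/-! ### The polynomial functor of a signature -/

namespace Signature

open SliceMonad

variable {O Q R : Type u}

/-- The polynomial endofunctor of `Set/O` given by a signature over `O`. -/
def poly (A : Signature O) : Over O ⥤ Over O where
  obj X := Over.mk (↾(Eval.out : Eval A X.hom → O))
  map f := overHom (Eval.lift A f.left (hom_left_apply f)) (Eval.out_map _ _ _)
  map_id _ := rfl
  map_comp _ _ := rfl

/-- The component at `X` of the transformation `A u^* ⟶ u^* B` of polynomial functors induced by a
morphism of signatures over `u`. -/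
noncomputable def pullbackTransApp {u : O ⟶ Q} {A : Signature O} {B : Signature Q}
    (f : SigHom u A B) (X : Over Q) :
    (poly A).obj ((Over.pullback u).obj X) ⟶ (Over.pullback u).obj ((poly B).obj X) :=
  pullbackLift (X := (poly A).obj ((Over.pullback u).obj X)) (Y := (poly B).obj X)
    (Eval.map f (proj u X) (proj_hom_apply u X)) (Eval.out_map f (proj u X) (proj_hom_apply u X))

theorem pullbackTransApp_proj {u : O ⟶ Q} {A : Signature O} {B : Signature Q} (f : SigHom u A B)
    (X : Over Q) (e : Eval A ((Over.pullback u).obj X).hom) :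
    proj u ((poly B).obj X) ((pullbackTransApp f X).left e) =
      Eval.map f (proj u X) (proj_hom_apply u X) e :=
  pullbackLift_proj (X := (poly A).obj ((Over.pullback u).obj X)) (Y := (poly B).obj X) _
    (Eval.out_map f (proj u X) (proj_hom_apply u X)) _

/-- The transformation `A u^* ⟶ u^* B` of polynomial functors induced by a morphism of signatures
over `u`. -/
noncomputable def pullbackTrans {u : O ⟶ Q} {A : Signature O} {B : Signature Q} (f : SigHom u A B) :
    Over.pullback u ⋙ poly A ⟶ poly B ⋙ Over.pullback u where
  app X := pullbackTransApp f X
  naturality X Y g := by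
    refine hom_ext_proj_apply fun e => ?_
    refine (pullbackTransApp_proj f Y (((poly A).map ((Over.pullback u).map g)).left e)).trans ?_
    refine Eq.trans ?_ (map_proj_apply u ((poly B).map g) ((pullbackTransApp f X).left e)).symm
    refine Eq.trans ?_ (congrArg ((poly B).map g).left (pullbackTransApp_proj f X e)).symm
    exact Eval.ext_arg fun j => map_proj_apply u g _

theorem pullbackTrans_proj {u : O ⟶ Q} {A : Signature O} {B : Signature Q} (f : SigHom u A B)
    (X : Over Q) (e : Eval A ((Over.pullback u).obj X).hom) :
    proj u ((poly B).obj X) (((pullbackTrans f).app X).left e) =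
      Eval.map f (proj u X) (proj_hom_apply u X) e :=
  pullbackTransApp_proj f X e

/-- The naturality squares of the projections from pullbacks along `u` are pullbacks, so the claim is
that the action of `f` on values, over `u`, is cartesian. -/
theorem pullbackTrans_equifibered {u : O ⟶ Q} {A : Signature O} {B : Signature Q}
    (f : SigHom u A B) : NatTrans.Equifibered (pullbackTrans f) := by
  rw [equifibered_iff]
  intro X Y g e z h
  have h' := (pullbackTrans_proj f Y e).symm.trans (congrArg (proj u ((poly B).obj Y)) h)
  obtain ⟨c, ⟨hc, hc'⟩, huniq⟩ := Eval.existsUnique_map f (hom_left_apply ((Over.pullback u).map g))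
    (hom_left_apply g) (proj_hom_apply u X) (proj_hom_apply u Y) (fun y x hyx => by
      obtain ⟨w, hw, hw'⟩ := pullback_exists (u := u) (Y := X) x (((Over.pullback u).obj Y).hom y)
        (by rw [← hom_left_apply g, ← hyx, proj_hom_apply])
      refine ⟨w, pullback_ext ?_ ?_, hw⟩
      · rw [map_proj_apply, hw, hyx]
      · rw [hom_left_apply, hw']) (fun x₁ x₂ h₁ h₂ => pullback_ext h₂ (by
          rw [← hom_left_apply ((Over.pullback u).map g), h₁, hom_left_apply])) e
    (proj u ((poly B).obj X) z) (h'.trans (map_proj_apply u ((poly B).map g) z))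
  refine ⟨c, ⟨hc, pullback_ext ((pullbackTrans_proj f X c).trans hc') ?_⟩, fun c' hc₁ => ?_⟩
  · have h₁ := hom_left_apply ((pullbackTrans f).app X) c
    have h₂ := hom_left_apply ((Over.pullback u).map ((poly B).map g)) z
    have h₃ := hom_left_apply ((pullbackTrans f).app Y) e
    refine h₁.trans (Eq.trans ?_ h₂)
    refine Eq.trans ?_ (congrArg _ h)
    refine Eq.trans ?_ h₃.symm
    exact (congrArg Eval.out hc).symm.trans (Eval.out_map _ _ _ _) |>.symm
  · exact huniq c' ⟨hc₁.1, (pullbackTrans_proj f X c').symm.trans (congrArg _ hc₁.2)⟩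

/-- The transformation of polynomial functors induced by a morphism of signatures over the
identity. -/
def polyTrans {A B : Signature O} (f : SigHom (fun x => x) A B) : poly A ⟶ poly B where
  app X := overHom (X := (poly A).obj X) (Y := (poly B).obj X) (Eval.trans f)
    (Eval.out_map f _ fun _ => rfl)
  naturality _ _ _ := rfl

theorem polyTrans_equifibered {A B : Signature O} (f : SigHom (fun x => x) A B) :
    NatTrans.Equifibered (polyTrans f) := by
  rw [equifibered_iff]
  intro X Y g e z h
  exact Eval.existsUnique_map f (hom_left_apply g) (hom_left_apply g) (fun _ => rfl)
    (fun _ => rfl) (fun y x hyx => ⟨x, hyx.symm, rfl⟩) (fun _ _ _ h => h) e z h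

/-- The polynomial functor of the unit signature is the identity. -/
def unitIso (O : Type u) : 𝟭 (Over O) ≅ poly (unit O) :=
  NatIso.ofComponents
    (fun X => Over.isoMk (g := (poly (unit O)).obj X) (Eval.unitEquiv X.hom).toIso (by ext; rfl))
    (fun {X Y} f => over_hom_ext fun x =>
      (Eval.unitEquiv_map f.left (hom_left_apply f) x).symm)

/-- The polynomial functor of `A ⊗ B` is the composite of those of `B` and of `A`. -/
def nestIso (A B : Signature O) : poly B ⋙ poly A ≅ poly (tensor A B) :=
  NatIso.ofComponents
    (fun X => Over.isoMk (f := (poly A).obj ((poly B).obj X)) (g := (poly (tensor A B)).obj X)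
      (Eval.nestEquiv A B X.hom).toIso (by ext; rfl))
    (fun {X Y} f => over_hom_ext fun e =>
      (Eval.nest_map (SigHom.id A) (SigHom.id B) f.left (hom_left_apply f) e).trans
        (by rw [tensorHom_id]; rfl))

/-! ### Exactness of polynomial functors -/

/-- An element of the polynomial functor is a map from the family of input types of its
operation. -/
def argHom {A : Signature O} {X : Over O} (e : Eval A X.hom) :
    Over.mk (↾(Eval.inpFamily A e.op)) ⟶ X :=
  overHom (X := Over.mk (↾(Eval.inpFamily A e.op))) (fun i => e.arg i.down)
    (fun i => e.type_arg i.down)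

theorem poly_preservesWidePullbacks (A : Signature O) (J : Type*) :
    PreservesLimitsOfShape (WidePullbackShape J) (poly A) := by
  suffices PreservesLimitsOfShape (WidePullbackShape J) (poly A ⋙ Over.forget O) from
    preservesLimitsOfShape_of_reflects_of_preserves (poly A) (Over.forget O)
  refine ⟨fun {K} => ⟨fun {c} hc => ?_⟩⟩
  rw [Types.isLimit_iff]
  intro s hs
  let e (j) : Eval A (K.obj j).hom := s j
  have he {i j} (φ : i ⟶ j) :
      Eval.lift A (K.map φ).left (hom_left_apply (K.map φ)) (e i) = e j := hs φ
  -- the operations of a compatible family agree, as the diagram is connected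
  obtain ⟨a, hop⟩ : ∃ a, ∀ j, (e j).op = a := by
    refine ⟨(e none).op, fun j => ?_⟩
    cases j with
    | none => rfl
    | some j => exact congrArg Eval.op (he (WidePullbackShape.Hom.term j))
  have hx (j) : ∃ x : Fin (A.arity a) → (K.obj j).left, ∃ h, e j = ⟨_, x, h⟩ := by
    rw [← hop j]
    exact ⟨_, _, rfl⟩
  choose x hx' hx using hx
  let d : Cone K :=
    { pt := Over.mk (↾(Eval.inpFamily A a))
      π :=
        { app := fun j => overHom (X := Over.mk (↾(Eval.inpFamily A a)))
            (fun i => x j i.down) (fun i => hx' j i.down)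
          naturality := fun i j φ => over_hom_ext fun k => by
            have h := he φ
            rw [hx, hx] at h
            exact (Eval.arg_eq_of_mk_eq h k.down).symm } }
  have hd (j) (i : Fin (A.arity a)) :
      (c.π.app j).left ((hc.lift d).left ⟨i⟩) = x j i := left_congr (hc.fac d j) ⟨i⟩
  refine ⟨(⟨a, fun i => (hc.lift d).left ⟨i⟩, fun i => hom_left_apply (hc.lift d) ⟨i⟩⟩ :
    Eval A c.pt.hom), fun j => ?_, fun y hy => ?_⟩
  · exact (Eval.ext_arg (hd j)).trans (hx j).symm
  · obtain ⟨b, y, hy'⟩ := (y : Eval A c.pt.hom)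
    have hy (j) : Eval.lift A (c.π.app j).left (hom_left_apply (c.π.app j)) ⟨b, y, hy'⟩ = e j :=
      hy j
    obtain rfl : b = a := (congrArg Eval.op (hy none)).trans (hop none)
    have hl : overHom (X := d.pt) (fun i => y i.down) (fun i => hy' i.down) = hc.lift d :=
      hc.uniq d _ fun j => over_hom_ext fun i => by
        have h := hy j
        rw [hx] at h
        exact Eval.arg_eq_of_mk_eq h i.down
    exact Eval.ext_arg fun i => left_congr hl ⟨i⟩

theorem poly_finitary (A : Signature O) : PreservesFilteredColimits (poly A) := by
  classical
  refine ⟨fun J _ _ => ?_⟩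
  suffices PreservesColimitsOfShape J (poly A ⋙ Over.forget O) from
    preservesColimitsOfShape_of_reflects_of_preserves (poly A) (Over.forget O)
  refine ⟨fun {K} => ⟨fun {c} hc => ⟨?_⟩⟩⟩
  have hc' := isColimitOfPreserves (Over.forget O) hc
  refine Types.FilteredColimit.isColimitOf' _ _ (fun e => ?_) fun j e e' h => ?_
  · obtain ⟨a, x, hx⟩ := (e : Eval A c.pt.hom)
    have h (i) : ∃ j, ∃ y : (K.obj j).left, (c.ι.app j).left y = x i :=
      Types.jointly_surjective_of_isColimit hc' (x i)
    choose j y hy using h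
    obtain ⟨k, hk⟩ := IsFiltered.sup_objs_exists (Finset.univ.image j)
    have φ (i) : j i ⟶ k := (hk (Finset.mem_image_of_mem j (Finset.mem_univ i))).some
    have hz (i) : (c.ι.app k).left ((K.map (φ i)).left (y i)) = x i :=
      (left_congr (c.w (φ i)) (y i)).trans (hy i)
    refine ⟨k, (⟨a, fun i => (K.map (φ i)).left (y i), fun i => ?_⟩ : Eval A (K.obj k).hom), ?_⟩
    · exact (hom_left_apply (c.ι.app k) _).symm.trans ((congrArg c.pt.hom (hz i)).trans (hx i))
    · symm
      exact Eval.ext_arg hz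
  · obtain ⟨a, x, hx⟩ := (e : Eval A (K.obj j).hom)
    obtain ⟨a', x', hx'⟩ := (e' : Eval A (K.obj j).hom)
    obtain rfl : a = a' := congrArg Eval.op h
    have h (i) : (c.ι.app j).left (x i) = (c.ι.app j).left (x' i) := Eval.arg_eq_of_mk_eq h i
    have h' (i) : ∃ k, ∃ φ : j ⟶ k, (K.map φ).left (x i) = (K.map φ).left (x' i) :=
      (Types.FilteredColimit.isColimit_eq_iff' hc' (x i) (x' i)).1 (h i)
    choose k φ hφ using h'
    obtain ⟨l, ψ, hψ⟩ := IsFiltered.sup_exists (insert j (Finset.univ.image k))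
      (Finset.univ.image fun i => ⟨j, k i, Finset.mem_insert_self _ _,
        Finset.mem_insert_of_mem (Finset.mem_image_of_mem k (Finset.mem_univ i)), φ i⟩)
    have hψ' (i) : φ i ≫ ψ (Finset.mem_insert_of_mem
        (Finset.mem_image_of_mem k (Finset.mem_univ i))) = ψ (Finset.mem_insert_self _ _) :=
      hψ _ _ (Finset.mem_image_of_mem _ (Finset.mem_univ i))
    refine ⟨l, ψ (Finset.mem_insert_self _ _), Eval.ext_arg fun i => ?_⟩
    change (K.map _).left (x i) = (K.map _).left (x' i)
    rw [← hψ' i, K.map_comp]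
    exact congrArg (K.map (ψ _)).left (hφ i)

end Signature

/-! ### The monad of a multicategory -/

namespace AmalgMulticat

open SliceMonad Signature

/-- The monad on `Set/O` of a multicategory with non-standard amalgamation over `O`. -/
def monad (M : AmalgMulticat.{u}) : Monad (Over M.obj) where
  toFunctor := poly M.sig
  η := (unitIso M.obj).hom ≫ polyTrans M.one
  μ := (nestIso M.sig M.sig).hom ≫ polyTrans M.mul
  assoc X := over_hom_ext fun e =>
    (Eval.mul_assoc_iff.1 M.mul_assoc X.left X.hom e).symm
  left_unit X := over_hom_ext fun e => Eval.one_mul_iff.1 M.one_mul X.left X.hom e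
  right_unit X := over_hom_ext fun e => Eval.mul_one_iff.1 M.mul_one X.left X.hom e

/-- The cartesian monad of a multicategory with non-standard amalgamation. -/
def toSliceMonad (M : AmalgMulticat.{u}) : SliceMonad.{u} where
  obj := M.obj
  monad := M.monad
  cartesian :=
    { preservesPullbacks := poly_preservesWidePullbacks M.sig WalkingPair
      unit_cartesian := (NatTrans.Equifibered.of_isIso _).comp (polyTrans_equifibered M.one)
      mul_cartesian := (NatTrans.Equifibered.of_isIso (nestIso M.sig M.sig).hom).comp
        (polyTrans_equifibered M.mul) }
  finitary := poly_finitary M.sig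
  preservesWidePullbacks := poly_preservesWidePullbacks M.sig

end AmalgMulticat

namespace Signature

open SliceMonad

variable {O Q R : Type u}

/-! ### Cartesian transformations over a map of sets of types -/

/-- A cartesian transformation of polynomial functors comes from a morphism of signatures. -/
theorem exists_polyTrans_eq {A B : Signature O} (θ : poly A ⟶ poly B)
    (hθ : NatTrans.Equifibered θ) : ∃ f : SigHom (fun x => x) A B, θ = polyTrans f := by
  rw [equifibered_iff] at hθ
  obtain ⟨f, hf⟩ := Eval.exists_sigHom (A := A) (B := B)
    (fun p e => (θ.app (Over.mk (↾p))).left e)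
    (fun p e => hom_left_apply (θ.app (Over.mk (↾p))) e)
    (fun p q k hk e => left_congr
      (θ.naturality (overHom (X := Over.mk (↾p)) (Y := Over.mk (↾q)) k hk)) e)
    (fun p q k hk e t h =>
      (hθ (overHom (X := Over.mk (↾p)) (Y := Over.mk (↾q)) k hk) e t h).exists)
  exact ⟨f, NatTrans.ext (funext fun X => over_hom_ext fun e => hf X.hom e)⟩

/-- The signature over `Q` with the operations of `A` and with types changed along `u`. -/
def push (u : O → Q) (A : Signature O) : Signature Q where
  Op := A.Op
  arity := A.arity
  out a := u (A.out a)
  inp a i := u (A.inp a i)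

/-- The opcartesian morphism from a signature to its change of types. -/
def toPush (u : O → Q) (A : Signature O) : SigHom u A (push u A) where
  toFun a := a
  amalg _ := Equiv.refl _
  out_toFun _ := rfl
  inp_toFun _ _ := rfl

theorem map_toPush_bijective (u : O ⟶ Q) (A : Signature O) (X : Over Q) :
    Function.Bijective (Eval.map (toPush u A) (proj u X) (proj_hom_apply u X)) := by
  constructor
  · rintro ⟨a, x, hx⟩ ⟨a', x', hx'⟩ h
    obtain rfl : a = a' := congrArg Eval.op h
    refine Eval.ext_arg fun i => pullback_ext (Eval.arg_eq_of_mk_eq h i) ?_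
    rw [hx, hx']
  · rintro ⟨a, x, hx⟩
    have h (i) := pullback_exists (u := u) (Y := X) (x i) (A.inp a i) (hx i)
    choose z hz hz' using h
    refine ⟨⟨a, z, hz'⟩, ?_⟩
    exact Eval.ext_arg (fun i => hz i)

/-- The polynomial functor of `push u A` is `A` applied to pullbacks along `u`. -/
noncomputable def pushEquiv (u : O ⟶ Q) (A : Signature O) (X : Over Q) :
    Eval A ((Over.pullback u).obj X).hom ≃ Eval (push u A) X.hom :=
  Equiv.ofBijective _ (map_toPush_bijective u A X)

theorem pushEquiv_lift (u : O ⟶ Q) (A : Signature O) {X Y : Over Q} (g : X ⟶ Y)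
    (e : Eval A ((Over.pullback u).obj X).hom) :
    Eval.lift _ g.left (hom_left_apply g) (pushEquiv u A X e) =
      pushEquiv u A Y (Eval.lift A ((Over.pullback u).map g).left (hom_left_apply _) e) := by
  symm
  exact Eval.ext_arg fun i => map_proj_apply u g _

/-- Morphisms of signatures over `u` are determined by their action on families pulled back along
`u`. -/
theorem sigHom_ext_proj {u : O ⟶ Q} {A : Signature O} {B : Signature Q} {f g : SigHom u A B}
    (h : ∀ (X : Over Q) (e : Eval A ((Over.pullback u).obj X).hom),
      Eval.map f (proj u X) (proj_hom_apply u X) e =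
        Eval.map g (proj u X) (proj_hom_apply u X) e) : f = g := by
  refine Eval.sigHom_ext fun a => ?_
  obtain ⟨e, he⟩ := (pushEquiv u A (Over.mk (↾fun i => u (Eval.inpFamily A a i)))).surjective
    ⟨a, fun i => ⟨i⟩, fun _ => rfl⟩
  obtain ⟨b, x, hx⟩ := e
  obtain rfl : b = a := congrArg Eval.op he
  have h' := h _ ⟨b, x, hx⟩
  have hx' := Eval.arg_eq_of_mk_eq he
  have key (f : SigHom u A B) :
      Eval.map f (proj u _) (proj_hom_apply u _) ⟨b, x, hx⟩ =
        Eval.map (q := fun i => u (Eval.inpFamily A b i)) f (fun i => i) (fun _ => rfl)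
          (Eval.generic A b) :=
    Eval.ext_arg fun j => hx' (f.amalg b j)
  exact (key f).symm.trans (h'.trans (key g))

/-- A cartesian transformation `A u^* ⟶ u^* B` comes from a morphism of signatures over `u`. -/
theorem exists_pullbackTrans_eq {u : O ⟶ Q} {A : Signature O} {B : Signature Q}
    (ξ : Over.pullback u ⋙ poly A ⟶ poly B ⋙ Over.pullback u) (hξ : NatTrans.Equifibered ξ) :
    ∃ f : SigHom u A B, ξ = pullbackTrans f := by
  rw [equifibered_iff] at hξ
  have hout (X : Over Q) (e : Eval A ((Over.pullback u).obj X).hom) :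
      (proj u ((poly B).obj X) ((ξ.app X).left e) : Eval B X.hom).out = u e.out :=
    (proj_hom_apply u ((poly B).obj X) ((ξ.app X).left e)).trans
      (congrArg u (hom_left_apply (ξ.app X) e))
  have hpush (X : Over Q) (e : Eval (push u A) X.hom) :
      u ((pushEquiv u A X).symm e).out = e.out :=
    congrArg Eval.out ((pushEquiv u A X).apply_symm_apply e)
  have hnat {X Y : Over Q} (g : X ⟶ Y) (e : Eval (push u A) X.hom) :
      (pushEquiv u A Y).symm (Eval.lift _ g.left (hom_left_apply g) e) =
        Eval.lift A ((Over.pullback u).map g).left (hom_left_apply _)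
          ((pushEquiv u A X).symm e) := by
    rw [Equiv.symm_apply_eq, ← pushEquiv_lift, Equiv.apply_symm_apply]
  -- composing `ξ` with the projections from the pullbacks gives a transformation over `Q`
  let θ : poly (push u A) ⟶ poly B :=
    { app := fun X => overHom (X := (poly (push u A)).obj X) (Y := (poly B).obj X)
        (fun e => proj u ((poly B).obj X) ((ξ.app X).left ((pushEquiv u A X).symm e)))
        (fun e => (hout X _).trans (hpush X e))
      naturality := fun X Y g => over_hom_ext fun e => by
        have h₁ := left_congr (ξ.naturality g) ((pushEquiv u A X).symm e)
        have h₂ := map_proj_apply u ((poly B).map g) ((ξ.app X).left ((pushEquiv u A X).symm e))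
        refine Eq.trans ?_ h₂
        refine Eq.trans ?_ (congrArg (proj u ((poly B).obj Y)) h₁)
        exact congrArg (fun e => proj u ((poly B).obj Y) ((ξ.app Y).left e)) (hnat g e) }
  have hθ : NatTrans.Equifibered θ := by
    rw [equifibered_iff]
    intro X Y g e t h
    have h : proj u ((poly B).obj Y) ((ξ.app Y).left ((pushEquiv u A Y).symm e)) =
      ((poly B).map g).left t := h
    obtain ⟨b, hb, hb'⟩ := pullback_exists (u := u) (Y := (poly B).obj X) t
      ((pushEquiv u A Y).symm e).out
      (((hom_left_apply ((poly B).map g) t).symm.trans (congrArg _ h.symm)).trans (hout Y _))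
    have hab : (ξ.app Y).left ((pushEquiv u A Y).symm e) =
        ((Over.pullback u).map ((poly B).map g)).left b := by
      refine pullback_ext ?_ ?_
      · rw [map_proj_apply, hb]
        exact h
      · rw [hom_left_apply, hb']
        exact hom_left_apply (ξ.app Y) _
    obtain ⟨c, ⟨hc, hc'⟩, huniq⟩ := hξ g ((pushEquiv u A Y).symm e) b hab
    refine ⟨pushEquiv u A X c, ⟨?_, ?_⟩, fun c' hc₁ => ?_⟩
    · refine (pushEquiv_lift u A g c).trans ?_
      exact ((pushEquiv u A Y).eq_symm_apply).1 hc
    · refine Eq.trans ?_ hb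
      refine congrArg (proj u ((poly B).obj X)) (Eq.trans ?_ hc')
      exact congrArg (ξ.app X).left ((pushEquiv u A X).symm_apply_apply c)
    · refine ((pushEquiv u A X).symm_apply_eq).1 (huniq _ ⟨?_, ?_⟩)
      · exact (hnat g c').symm.trans (congrArg (pushEquiv u A Y).symm hc₁.1)
      · refine pullback_ext (hc₁.2.trans hb.symm) ?_
        rw [hb']
        refine (hom_left_apply (ξ.app X) _).trans ?_
        exact congrArg Eval.out ((hnat g c').symm.trans (congrArg (pushEquiv u A Y).symm hc₁.1))
  obtain ⟨f, hf⟩ := exists_polyTrans_eq θ hθ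
  refine ⟨(toPush u A).comp f, NatTrans.ext (funext fun X => hom_ext_proj_apply fun e => ?_)⟩
  refine Eq.trans ?_ (pullbackTrans_proj ((toPush u A).comp f) X e).symm
  refine Eq.trans ?_ (left_congr (congrArg (fun θ : poly (push u A) ⟶ poly B => θ.app X) hf)
    (pushEquiv u A X e))
  refine congrArg (fun e => proj u ((poly B).obj X) ((ξ.app X).left e)) ?_
  exact ((pushEquiv u A X).symm_apply_apply e).symm

theorem pullbackTrans_injective {u : O ⟶ Q} {A : Signature O} {B : Signature Q}
    {f g : SigHom u A B} (h : pullbackTrans f = pullbackTrans g) : f = g :=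
  sigHom_ext_proj fun X e => by
    rw [← pullbackTrans_proj, ← pullbackTrans_proj, h]

end Signature

/-! ### The functor from multicategories to monads -/

namespace AmalgMulticat

open SliceMonad Signature

/-- The two sides of the compatibility of `pullbackTrans f` with multiplications. -/
theorem proj_mul_pullbackTrans {M N : AmalgMulticat.{u}} {v : M.obj ⟶ N.obj}
    (f : SigHom v M.sig N.sig) (X : Over N.obj)
    (e : Eval M.sig (Eval.out : Eval M.sig ((Over.pullback v).obj X).hom → M.obj)) :
    SliceMonad.proj v (N.monad.obj X)
        ((M.monad.map ((pullbackTrans f).app X) ≫ (pullbackTrans f).app (N.monad.obj X) ≫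
          (Over.pullback v).map (N.monad.μ.app X)).left e) =
      Eval.mul N.mul (Eval.map f (Eval.map f (SliceMonad.proj v X) (proj_hom_apply v X))
        (Eval.out_map f _ _) e) := by
  refine (map_proj_apply v (N.monad.μ.app X) _).trans ?_
  refine congrArg (Eval.mul N.mul) ?_
  refine (pullbackTrans_proj f (N.monad.obj X) ((M.monad.map ((pullbackTrans f).app X)).left e)).trans
    ?_
  exact Eval.ext_arg fun j => pullbackTrans_proj f X _

/-- A morphism of signatures commutes with multiplications and units if and only if the induced
transformation of polynomial functors does. -/
theorem mul_hom_iff {M N : AmalgMulticat.{u}} {v : M.obj ⟶ N.obj} (f : SigHom v M.sig N.sig) :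
    M.mul.comp f = (tensorHom f f).comp N.mul ↔
      ∀ X : Over N.obj, M.monad.μ.app ((Over.pullback v).obj X) ≫ (pullbackTrans f).app X =
        M.monad.map ((pullbackTrans f).app X) ≫ (pullbackTrans f).app (N.monad.obj X) ≫
          (Over.pullback v).map (N.monad.μ.app X) := by
  refine ⟨fun h X => hom_ext_proj_apply fun e => ?_, fun h => sigHom_ext_proj fun X e => ?_⟩
  · refine Eq.trans ?_ (proj_mul_pullbackTrans f X e).symm
    refine (pullbackTrans_proj f X (Eval.mul M.mul e)).trans ?_
    exact Eval.map_mul h _ _ e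
  · obtain ⟨e, rfl⟩ := (Eval.nestEquiv _ _ _).surjective e
    have h' := congrArg (SliceMonad.proj v (N.monad.obj X)) (left_congr (h X) e)
    refine (pullbackTrans_proj f X (Eval.mul M.mul e)).symm.trans (h'.trans ?_)
    refine (proj_mul_pullbackTrans f X e).trans ?_
    exact congrArg (Eval.trans N.mul) (Eval.nest_map f f _ _ e)

theorem one_hom_iff {M N : AmalgMulticat.{u}} {v : M.obj ⟶ N.obj} (f : SigHom v M.sig N.sig) :
    M.one.comp f = (unitHom v).comp N.one ↔
      ∀ X : Over N.obj, M.monad.η.app ((Over.pullback v).obj X) ≫ (pullbackTrans f).app X =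
        (Over.pullback v).map (N.monad.η.app X) := by
  refine ⟨fun h X => hom_ext_proj_apply fun x => ?_, fun h => sigHom_ext_proj fun X e => ?_⟩
  · refine Eq.trans ?_ (map_proj_apply v (N.monad.η.app X) x).symm
    refine (pullbackTrans_proj f X (Eval.one M.one _ x)).trans ?_
    exact Eval.map_one h _ _ x
  · obtain ⟨x, rfl⟩ := (Eval.unitEquiv _).surjective e
    have h' := congrArg (SliceMonad.proj v (N.monad.obj X)) (left_congr (h X) x)
    refine (pullbackTrans_proj f X (Eval.one M.one _ x)).symm.trans (h'.trans ?_)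
    refine (map_proj_apply v (N.monad.η.app X) x).trans ?_
    exact congrArg (Eval.trans N.one) (Eval.unitEquiv_map _ (proj_hom_apply v X) x).symm

/-- The morphism of monads induced by a morphism of multicategories. -/
noncomputable def toSliceMonadHom {M N : AmalgMulticat.{u}} (v : M.obj ⟶ N.obj)
    (f : SigHom v M.sig N.sig) (hmul : M.mul.comp f = (tensorHom f f).comp N.mul)
    (hone : M.one.comp f = (unitHom v).comp N.one) :
    SliceMonad.Hom (toSliceMonad M) (toSliceMonad N) where
  base := v
  trans := pullbackTrans f
  cartesian := pullbackTrans_equifibered f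
  unit_trans := (one_hom_iff f).1 hone
  mul_trans := (mul_hom_iff f).1 hmul

theorem pullbackTrans_id {O : Type u} (A : Signature O) :
    pullbackTrans (u := 𝟙 O) (SigHom.id A) = idTrans (poly A) := by
  refine NatTrans.ext (funext fun X => hom_ext_proj_apply fun e => ?_)
  refine (pullbackTrans_proj (u := 𝟙 O) (SigHom.id A) X e).trans ?_
  refine Eq.trans ?_ (ConcreteCategory.congr_hom (idTrans_proj (poly A) X) e).symm
  exact Eval.ext_arg fun j => (ConcreteCategory.congr_hom (pullbackId_hom X) _).symm

theorem compTrans_proj_apply {O Q R : Type u} {u : O ⟶ Q} {v : Q ⟶ R}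
    {S : Over O ⥤ Over O} {T : Over Q ⥤ Over Q} {W : Over R ⥤ Over R}
    (ξ : Over.pullback u ⋙ S ⟶ T ⋙ Over.pullback u)
    (ζ : Over.pullback v ⋙ T ⟶ W ⋙ Over.pullback v) (X : Over R)
    (e : (S.obj ((Over.pullback (u ≫ v)).obj X)).left) :
    SliceMonad.proj (u ≫ v) (W.obj X) (((compTrans ξ ζ).app X).left e) =
      SliceMonad.proj v (W.obj X) ((ζ.app X).left (SliceMonad.proj u (T.obj _)
        ((ξ.app ((Over.pullback v).obj X)).left
          ((S.map ((Over.pullbackComp u v).hom.app X)).left e)))) := by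
  have h := ConcreteCategory.congr_hom (compTrans_proj ξ ζ X) e
  simp only [CategoryTheory.comp_apply] at h
  exact h

theorem pullbackTrans_comp {O Q R : Type u} {u : O ⟶ Q} {v : Q ⟶ R} {A : Signature O}
    {B : Signature Q} {C : Signature R} (f : SigHom u A B) (g : SigHom v B C) :
    pullbackTrans (u := u ≫ v) (f.comp g) = compTrans (pullbackTrans f) (pullbackTrans g) := by
  refine NatTrans.ext (funext fun X => hom_ext_proj_apply fun (e : Eval A _) => ?_)
  let e' : Eval A ((Over.pullback u).obj ((Over.pullback v).obj X)).hom :=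
    Eval.lift A ((Over.pullbackComp u v).hom.app X).left (hom_left_apply _) e
  have h₀ : SliceMonad.proj (u ≫ v) ((poly C).obj X)
      (((compTrans (pullbackTrans f) (pullbackTrans g)).app X).left e) =
      SliceMonad.proj v ((poly C).obj X) (((pullbackTrans g).app X).left
        (SliceMonad.proj u ((poly B).obj ((Over.pullback v).obj X))
          (((pullbackTrans f).app ((Over.pullback v).obj X)).left e'))) :=
    compTrans_proj_apply (pullbackTrans f) (pullbackTrans g) X e
  have h₁ := pullbackTrans_proj f ((Over.pullback v).obj X) e'
  have h₂ := pullbackTrans_proj g X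
    (Eval.map f (SliceMonad.proj u ((Over.pullback v).obj X)) (proj_hom_apply u _) e')
  have h₃ : Eval.map (f.comp g) (SliceMonad.proj (u ≫ v) X) (proj_hom_apply (u ≫ v) X) e =
      Eval.map g (SliceMonad.proj v X) (proj_hom_apply v X)
        (Eval.map f (SliceMonad.proj u ((Over.pullback v).obj X)) (proj_hom_apply u _) e') := by
    symm
    exact Eval.ext_arg fun j => ConcreteCategory.congr_hom (pullbackComp_hom_proj u v X) _
  refine (pullbackTrans_proj (u := u ≫ v) (f.comp g) X e).trans (h₃.trans ?_)
  refine Eq.trans ?_ h₀.symm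
  refine h₂.symm.trans ?_
  exact congrArg (fun z => SliceMonad.proj v ((poly C).obj X)
    (((pullbackTrans g).app X).left z)) h₁.symm

/-- The functor sending a multicategory with non-standard amalgamation to its monad. -/
noncomputable def toSliceMonadFunctor : AmalgMulticat.{u} ⥤ SliceMonad.{u} where
  obj := toSliceMonad
  map f := toSliceMonadHom (↾f.base) f.hom f.mul_hom f.one_hom
  map_id M := SliceMonad.Hom.ext rfl (heq_of_eq (pullbackTrans_id M.sig))
  map_comp f g := SliceMonad.Hom.ext rfl
    (heq_of_eq (pullbackTrans_comp (u := ↾f.base) (v := ↾g.base) f.hom g.hom))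

instance : toSliceMonadFunctor.{u}.Faithful where
  map_injective {M N} f g h := by
    obtain ⟨v, f, _, _⟩ := f
    obtain ⟨w, g, _, _⟩ := g
    have hb : ↾v = ↾w := congrArg SliceMonad.Hom.base h
    obtain rfl : v = w := funext fun x => ConcreteCategory.congr_hom hb x
    obtain rfl : f = g := by
      refine pullbackTrans_injective (u := ↾v) ?_
      exact (SliceMonad.Hom.mk.inj h).2.eq
    rfl

instance : toSliceMonadFunctor.{u}.Full where
  map_surjective {M N} ξ := by
    obtain ⟨v, ξ, hξ, hone, hmul⟩ := ξ
    obtain ⟨f, rfl⟩ := exists_pullbackTrans_eq (A := M.sig) (B := N.sig) ξ hξ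
    exact ⟨⟨v, f, (mul_hom_iff f).2 hmul, (one_hom_iff f).2 hone⟩, rfl⟩

end AmalgMulticat

namespace SliceMonad

open Signature

variable {O : Type u}

/-! ### Finite supports -/

/-- The family of elements of a finite set of elements of a family. -/
def finsetSub (X : Over O) (s : Finset X.left) : Over O :=
  Over.mk (↾fun x : {x // x ∈ s} => X.hom x.1)

/-- The inclusion of a finite set of elements of a family. -/
def finsetIncl (X : Over O) (s : Finset X.left) : finsetSub X s ⟶ X :=
  overHom (X := finsetSub X s) (fun x => x.1) (fun _ => rfl)

/-- The diagram of the finite sets of elements of a family. -/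
def finsetDiagram (X : Over O) : Finset X.left ⥤ Over O where
  obj s := finsetSub X s
  map {s s'} h := overHom (X := finsetSub X s) (Y := finsetSub X s')
    (fun x => ⟨x.1, leOfHom h x.2⟩) (fun _ => rfl)

/-- A family is the colimit of its finite subsets. -/
noncomputable def finsetIsColimit (X : Over O) :
    IsColimit ({ pt := X, ι := { app := finsetIncl X } } : Cocone (finsetDiagram X)) := by
  classical
  refine isColimitOfReflects (Over.forget O) (Types.FilteredColimit.isColimitOf' _ _
    (fun x => ⟨{x}, ⟨x, Finset.mem_singleton_self x⟩, rfl⟩) (fun s x y h => ⟨s, 𝟙 s, ?_⟩))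
  exact congrArg _ (Subtype.ext h)

/-- Elements of the value of a finitary functor have finite supports. -/
theorem exists_finset_support (T : Over O ⥤ Over O) [PreservesFilteredColimits T] {X : Over O}
    (t : (T.obj X).left) :
    ∃ (s : Finset X.left) (z : (T.obj (finsetSub X s)).left),
      (T.map (finsetIncl X s)).left z = t := by
  classical
  exact Types.jointly_surjective_of_isColimit
    (isColimitOfPreserves (Over.forget O) (isColimitOfPreserves T (finsetIsColimit X))) t

/-! ### Generic elements -/

/-- The map from a family to the terminal family. -/
noncomputable def toTop (X : Over O) : X ⟶ Over.mk (𝟙 O) := Over.mkIdTerminal.from X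

theorem comp_toTop {X Y : Over O} (f : X ⟶ Y) : f ≫ toTop Y = toTop X :=
  Over.mkIdTerminal.hom_ext _ _

theorem map_toTop (T : Over O ⥤ Over O) {X Y : Over O} (f : X ⟶ Y) (t : (T.obj X).left) :
    (T.map (toTop Y)).left ((T.map f).left t) = (T.map (toTop X)).left t := by
  rw [← comp_toTop f, T.map_comp]
  rfl

/-- An element `g` of `T G` is generic if it is initial among the elements of values of `T` with the
same image as `g` at the terminal family. -/
def IsGeneric (T : Over O ⥤ Over O) {G : Over O} (g : (T.obj G).left) : Prop :=
  ∀ ⦃Y : Over O⦄ (y : (T.obj Y).left), (T.map (toTop Y)).left y = (T.map (toTop G)).left g →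
    ∃! h : G ⟶ Y, (T.map h).left g = y

theorem IsGeneric.map_iso {T : Over O ⥤ Over O} {G G' : Over O} {g : (T.obj G).left}
    (hg : IsGeneric T g) (e : G ≅ G') : IsGeneric T ((T.map e.hom).left g) := by
  intro Y y hy
  rw [map_toTop] at hy
  obtain ⟨h, hh, huniq⟩ := hg y hy
  have key (k : G' ⟶ Y) :
      (T.map k).left ((T.map e.hom).left g) = (T.map (e.hom ≫ k)).left g := by
    rw [T.map_comp]
    rfl
  refine ⟨e.inv ≫ h, ?_, fun k hk => ?_⟩
  · change (T.map (e.inv ≫ h)).left ((T.map e.hom).left g) = y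
    rw [key, Iso.hom_inv_id_assoc, hh]
  · rw [Iso.eq_inv_comp]
    exact huniq _ ((key k).symm.trans hk)

theorem map_isPullback (T : Over O ⥤ Over O) [PreservesLimitsOfShape WalkingCospan T]
    {P X Y Z : Over O} {fst : P ⟶ X} {snd : P ⟶ Y} {f : X ⟶ Z} {g : Y ⟶ Z}
    (h : IsPullback fst snd f g) (x : (T.obj X).left) (y : (T.obj Y).left)
    (hxy : (T.map f).left x = (T.map g).left y) :
    ∃! z, (T.map fst).left z = x ∧ (T.map snd).left z = y :=
  (isPullback_iff (by rw [← T.map_comp, h.w, T.map_comp])).1 (h.map T) x y hxy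

/-- A functor preserving pullbacks preserves the equalizers of parallel maps, as these are pullbacks
along the diagonal of a product over the terminal object. -/
theorem exists_map_equalizer (T : Over O ⥤ Over O) [PreservesLimitsOfShape WalkingCospan T]
    {G Y : Over O} (f h : G ⟶ Y) (g : (T.obj G).left) (hg : (T.map f).left g = (T.map h).left g) :
    ∃ (E : Over O) (i : E ⟶ G) (e : (T.obj E).left), i ≫ f = i ≫ h ∧ (T.map i).left e = g := by
  have hw (a b : G ⟶ Y) : a ≫ toTop Y = b ≫ toTop Y := (comp_toTop a).trans (comp_toTop b).symm
  let k := pullback.lift f h (hw f h)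
  let d := pullback.lift (𝟙 Y) (𝟙 Y) (rfl : 𝟙 Y ≫ toTop Y = _)
  have hk₁ : k ≫ pullback.fst _ _ = f := pullback.lift_fst _ _ _
  have hk₂ : k ≫ pullback.snd _ _ = h := pullback.lift_snd _ _ _
  have hd₁ : d ≫ pullback.fst _ _ = 𝟙 Y := pullback.lift_fst _ _ _
  have hd₂ : d ≫ pullback.snd _ _ = 𝟙 Y := pullback.lift_snd _ _ _
  have happ {A B C : Over O} (a : A ⟶ B) (b : B ⟶ C) (t : (T.obj A).left) :
      (T.map b).left ((T.map a).left t) = (T.map (a ≫ b)).left t := by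
    rw [T.map_comp]
    rfl
  have hkd : (T.map k).left g = (T.map d).left ((T.map f).left g) := by
    refine (map_isPullback T (IsPullback.of_hasPullback (toTop Y) (toTop Y)) ((T.map f).left g)
      ((T.map h).left g) ?_).unique ⟨?_, ?_⟩ ⟨?_, ?_⟩
    · rw [map_toTop, map_toTop]
    · rw [happ, hk₁]
    · rw [happ, hk₂]
    · rw [happ, happ, hd₁, Category.comp_id]
    · rw [happ, happ, hd₂, Category.comp_id, hg]
  obtain ⟨e, ⟨he, -⟩, -⟩ := map_isPullback T (IsPullback.of_hasPullback k d) _ _ hkd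
  refine ⟨_, pullback.fst k d, e, ?_, he⟩
  rw [← hk₁, ← hk₂, pullback.condition_assoc, pullback.condition_assoc, hd₁, hd₂]

/-- A finite set of elements is isomorphic to a family indexed by some `Fin n`. Unlike the finite sets
themselves, these families form a small set, so that a product over all of them exists. -/
theorem exists_fin_iso {X : Over O} (s : Finset X.left) :
    ∃ (n : ℕ) (p : ULift.{u} (Fin n) → O), Nonempty (finsetSub X s ≅ Over.mk (↾p)) :=
  ⟨s.card, fun i => X.hom (s.equivFin.symm i.down).1,
    ⟨Over.isoMk (f := finsetSub X s) (s.equivFin.trans Equiv.ulift.symm).toIso (by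
      ext x
      exact congrArg (fun x : {x // x ∈ s} => X.hom x.1) (s.equivFin.symm_apply_apply x))⟩⟩

/-- Over each element of the value of `T` at the terminal family there is an element which maps to
all elements over it: it lives in the product of all the finite ones. -/
theorem exists_weaklyInitial (T : Over O ⥤ Over O) [PreservesFilteredColimits T]
    [∀ J : Type u, PreservesLimitsOfShape (WidePullbackShape J) T]
    (t : (T.obj (Over.mk (𝟙 O))).left) :
    ∃ (L : Over O) (q : (T.obj L).left), (T.map (toTop L)).left q = t ∧
      ∀ (Y : Over O) (y : (T.obj Y).left), (T.map (toTop Y)).left y = t →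
        ∃ h : L ⟶ Y, (T.map h).left q = y := by
  let I : Type u := (n : ℕ) × (p : ULift.{u} (Fin n) → O) ×
    {x : (T.obj (Over.mk (↾p))).left // (T.map (toTop _)).left x = t}
  let K : WidePullbackShape I ⥤ Over O := WidePullbackShape.wideCospan (Over.mk (𝟙 O))
    (fun i => Over.mk (↾i.2.1)) (fun i => toTop _)
  have hlim := isLimitOfPreserves (Over.forget O) (isLimitOfPreserves T (limit.isLimit K))
  let s (j : WidePullbackShape I) : (T.obj (K.obj j)).left :=
    match j with
    | none => t
    | some i => i.2.2.1
  have hs {i j : WidePullbackShape I} (φ : i ⟶ j) :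
      (T.map (K.map φ)).left (s i) = s j := by
    match i, j, φ with
    | _, _, .id j =>
      change (T.map (K.map (𝟙 j))).left (s j) = s j
      rw [K.map_id, T.map_id]
      rfl
    | _, _, .term i => exact i.2.2.2
  obtain ⟨q, hq, -⟩ := (Types.isLimit_iff _).1 ⟨hlim⟩ s hs
  have hq (j) : (T.map (limit.π K j)).left q = s j := hq j
  have htop : limit.π K none = toTop (limit K) := Over.mkIdTerminal.hom_ext _ _
  refine ⟨limit K, q, ?_, fun Y y hy => ?_⟩
  · rw [← htop]
    exact hq none
  · obtain ⟨s', z, hz⟩ := exists_finset_support T y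
    obtain ⟨n, p, ⟨e⟩⟩ := exists_fin_iso s'
    let i : I := ⟨n, p, (T.map e.hom).left z, by
      rw [map_toTop, ← map_toTop T (finsetIncl Y s'), hz, hy]⟩
    refine ⟨limit.π K (some i) ≫ e.inv ≫ finsetIncl Y s', ?_⟩
    rw [T.map_comp]
    refine (congrArg (T.map (e.inv ≫ finsetIncl Y s')).left (hq (some i))).trans ?_
    refine Eq.trans ?_ hz
    change (T.map e.hom ≫ T.map (e.inv ≫ finsetIncl Y s')).left z = _
    rw [← T.map_comp, Iso.hom_inv_id_assoc]

/-- The values of a finitary functor preserving wide pullbacks have finite generic elements: a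
weakly initial element becomes initial when restricted to a minimal finite support. -/
theorem exists_isGeneric (T : Over O ⥤ Over O) [PreservesFilteredColimits T]
    [PreservesLimitsOfShape WalkingCospan T]
    [∀ J : Type u, PreservesLimitsOfShape (WidePullbackShape J) T]
    (t : (T.obj (Over.mk (𝟙 O))).left) :
    ∃ (n : ℕ) (p : ULift.{u} (Fin n) → O) (g : (T.obj (Over.mk (↾p))).left),
      (T.map (toTop _)).left g = t ∧ IsGeneric T g := by
  classical
  obtain ⟨L, q, hq, hinit⟩ := exists_weaklyInitial T t
  obtain ⟨s, ⟨z, hz⟩, hmin⟩ := WellFounded.has_min (measure (Finset.card (α := L.left))).wf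
    {s | ∃ z : (T.obj (finsetSub L s)).left, (T.map (finsetIncl L s)).left z = q}
    (exists_finset_support T q)
  have hzt : (T.map (toTop (finsetSub L s))).left z = t := by
    rw [← map_toTop T (finsetIncl L s), hz, hq]
  have hgen : IsGeneric T z := by
    intro Y y hy
    obtain ⟨h, hh⟩ := hinit Y y (hy.trans hzt)
    have hex : (T.map (finsetIncl L s ≫ h)).left z = y := by
      rw [T.map_comp, ← hh, ← hz]
      rfl
    refine ⟨finsetIncl L s ≫ h, hex, fun k hk => ?_⟩
    obtain ⟨E, i, e, hi, he⟩ := exists_map_equalizer T k (finsetIncl L s ≫ h) z (hk.trans hex.symm)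
    -- the elements of `s` at which the two maps agree support `q`, hence are all of `s`
    let s' : Finset L.left := (Finset.univ.filter fun x : {x // x ∈ s} =>
      k.left x = (finsetIncl L s ≫ h).left x).map (Function.Embedding.subtype _)
    let i' : E ⟶ finsetSub L s' := overHom (Y := finsetSub L s')
      (fun x => ⟨(i.left x).1, Finset.mem_map.2 ⟨i.left x, Finset.mem_filter.2
        ⟨Finset.mem_univ _, left_congr hi x⟩, rfl⟩⟩) (fun x => hom_left_apply i x)
    have hs' : ∃ z' : (T.obj (finsetSub L s')).left, (T.map (finsetIncl L s')).left z' = q := by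
      refine ⟨(T.map i').left e, ?_⟩
      change (T.map i' ≫ T.map (finsetIncl L s')).left e = q
      rw [← T.map_comp, ← hz, ← he]
      change _ = (T.map i ≫ T.map (finsetIncl L s)).left e
      rw [← T.map_comp]
      rfl
    have hcard : s.card ≤ s'.card := not_lt.1 (hmin s' hs')
    have hsub : s' ⊆ s := by
      intro x hx
      obtain ⟨y, -, rfl⟩ := Finset.mem_map.1 hx
      exact y.2
    have hss' : s' = s := Finset.eq_of_subset_of_card_le hsub hcard
    refine over_hom_ext fun x => ?_
    have hx : x.1 ∈ s' := by
      rw [hss']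
      exact x.2
    obtain ⟨x', hx', hxx'⟩ := Finset.mem_map.1 hx
    obtain rfl : x' = x := Subtype.ext hxx'
    exact (Finset.mem_filter.1 hx').2
  obtain ⟨n, p, ⟨e⟩⟩ := exists_fin_iso s
  exact ⟨n, p, (T.map e.hom).left z, by rw [map_toTop, hzt], hgen.map_iso e⟩

/-! ### Finitary functors preserving wide pullbacks are polynomial -/

/-- The operations of the signature of `T` are the elements of `T` at the terminal family, and the
inputs of an operation are those of a generic element over it. -/
theorem exists_poly_iso (T : Over O ⥤ Over O) [PreservesFilteredColimits T]
    [PreservesLimitsOfShape WalkingCospan T]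
    [∀ J : Type u, PreservesLimitsOfShape (WidePullbackShape J) T] :
    ∃ A : Signature O, Nonempty (poly A ≅ T) := by
  choose n p g hg hgen using exists_isGeneric T
  let A : Signature O :=
    { Op := (T.obj (Over.mk (𝟙 O))).left
      arity := n
      out := fun t => (T.obj (Over.mk (𝟙 O))).hom t
      inp := fun t i => p t ⟨i⟩ }
  let α (X : Over O) (e : Eval A X.hom) : (T.obj X).left := (T.map (argHom e)).left (g e.op)
  have hα (X : Over O) (e : Eval A X.hom) : (T.obj X).hom (α X e) = e.out := by
    refine (hom_left_apply _ _).trans ?_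
    refine (hom_left_apply (T.map (toTop _)) (g e.op)).symm.trans ?_
    exact congrArg _ (hg e.op)
  have hop {X : Over O} (e : Eval A X.hom) : (T.map (toTop X)).left (α X e) = e.op :=
    (map_toTop T (argHom e) _).trans (hg _)
  have hbij (X : Over O) : Function.Bijective (α X) := by
    constructor
    · rintro ⟨a, x, hx⟩ ⟨b, y, hy⟩ h
      obtain rfl : a = b := (hop _).symm.trans ((congrArg _ h).trans (hop _))
      have h' := (hgen a (α X ⟨a, x, hx⟩) ((hop _).trans (hg _).symm)).unique rfl h.symm
      exact Eval.ext_arg fun i => left_congr h' ⟨i⟩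
    · intro y
      obtain ⟨h, hh, -⟩ := hgen ((T.map (toTop X)).left y) y (hg _).symm
      exact ⟨⟨_, fun i => h.left ⟨i⟩, fun i => hom_left_apply h ⟨i⟩⟩, hh⟩
  refine ⟨A, ⟨NatIso.ofComponents (fun X => Over.isoMk (f := (poly A).obj X)
    (Equiv.ofBijective (α X) (hbij X)).toIso (by ext e; exact hα X e))
    (fun {X Y} f => over_hom_ext fun e => ?_)⟩⟩
  change (T.map (argHom e ≫ f)).left _ = _
  rw [T.map_comp]
  rfl

end SliceMonad

namespace SliceMonad

open Signature

variable {O : Type u}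

/-! ### Vertical morphisms of monads -/

/-- A transformation between endofunctors of `Set/O`, seen as one over the identity of `O`. -/
noncomputable def verticalTrans {S T : Over O ⥤ Over O} (α : S ⟶ T) :
    Over.pullback (𝟙 O) ⋙ S ⟶ T ⋙ Over.pullback (𝟙 O) :=
  idTrans S ≫ Functor.whiskerRight α (Over.pullback (𝟙 O))

theorem verticalTrans_proj {S T : Over O ⥤ Over O} (α : S ⟶ T) (X : Over O) :
    ((verticalTrans α).app X).left ≫ proj (𝟙 O) (T.obj X) =
      (S.map (Over.pullbackId.hom.app X)).left ≫ (α.app X).left := by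
  change (((idTrans S).app X).left ≫ ((Over.pullback (𝟙 O)).map (α.app X)).left) ≫ _ = _
  rw [Category.assoc, map_proj, reassoc_of% idTrans_proj]

theorem verticalTrans_comp {S T W : Over O ⥤ Over O} (α : S ⟶ T) (β : T ⟶ W) :
    HEq (compTrans (verticalTrans α) (verticalTrans β)) (verticalTrans (α ≫ β)) := by
  refine trans_hext (Category.id_comp (𝟙 O)) fun X e => ?_
  have h : (Over.pullbackComp (𝟙 O) (𝟙 O)).hom.app X ≫
      Over.pullbackId.hom.app ((Over.pullback (𝟙 O)).obj X) = eqToHom e :=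
    hom_ext_proj (by
      rw [Over.comp_left, Category.assoc, pullbackId_hom,
        eqToHom_proj (Category.id_comp (𝟙 O)), pullbackComp_hom_proj])
  have h₂ := congrArg Over.Hom.left (α.naturality (Over.pullbackId.hom.app X))
  rw [Over.comp_left, Over.comp_left] at h₂
  dsimp only [Functor.id_obj] at h₂
  rw [compTrans_proj, reassoc_of% verticalTrans_proj, verticalTrans_proj, verticalTrans_proj,
    ← h, S.map_comp, Over.comp_left, Category.assoc, NatTrans.comp_app, Over.comp_left,
    reassoc_of% h₂]

theorem verticalTrans_id (S : Over O ⥤ Over O) : verticalTrans (𝟙 S) = idTrans S := by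
  simp [verticalTrans]

theorem verticalTrans_pullbackId {S T : Over O ⥤ Over O} (α : S ⟶ T) (X : Over O) :
    (verticalTrans α).app X ≫ Over.pullbackId.hom.app (T.obj X) =
      S.map (Over.pullbackId.hom.app X) ≫ α.app X := by
  ext1
  rw [Over.comp_left, Over.comp_left, pullbackId_hom]
  exact verticalTrans_proj α X

/-- A cartesian morphism of monads on `Set/O`, as a morphism over the identity of `O`. -/
noncomputable def verticalHom {m m' : Monad (Over O)} {c f w c' f' w'} (α : m ⟶ m')
    (hα : NatTrans.Equifibered α.toNatTrans) : Hom ⟨O, m, c, f, w⟩ ⟨O, m', c', f', w'⟩ where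
  base := 𝟙 O
  trans := verticalTrans α.toNatTrans
  cartesian := (Hom.id ⟨O, m, c, f, w⟩).cartesian.comp (hα.whiskerRight _)
  unit_trans X := by
    have h := (Hom.id ⟨O, m, c, f, w⟩).unit_trans X
    have h' := congrArg (Over.pullback (𝟙 O)).map (α.app_η X)
    rw [Functor.map_comp] at h'
    exact (Category.assoc _ _ _).symm.trans ((congrArg (· ≫ _) h).trans h')
  mul_trans X := by
    have h₁ := verticalTrans_pullbackId α.toNatTrans X
    have h₂ := verticalTrans_pullbackId α.toNatTrans (m'.obj X)
    have h₃ := (Over.pullbackId (X := O)).hom.naturality (m'.μ.app X)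
    have h₄ := m.μ.naturality (Over.pullbackId.hom.app X)
    have h₅ := α.app_μ X
    have h₆ := congrArg m.map h₁
    dsimp only [Functor.comp_obj, Functor.comp_map, Functor.id_obj, Functor.id_map] at h₂ h₃ h₄ h₅
    rw [m.map_comp, m.map_comp] at h₆
    rw [← cancel_mono (Over.pullbackId.hom.app _)]
    simp only [Category.assoc]
    refine (congrArg (m.μ.app _ ≫ ·) h₁).trans ?_
    rw [← reassoc_of% h₄, h₅]
    symm
    refine (congrArg (fun k => m.map _ ≫ _ ≫ k) h₃).trans ?_
    rw [reassoc_of% h₂, reassoc_of% h₆, Category.assoc]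

theorem equifibered_of_iso {C : Type*} [Category* C] {m m' : Monad C} (α : m ≅ m') :
    NatTrans.Equifibered α.hom.toNatTrans :=
  NatTrans.Equifibered.of_isIso ((monadToFunctor C).mapIso α).hom

/-- Isomorphic monads on `Set/O` are isomorphic over the identity of `O`. -/
noncomputable def verticalIso {m m' : Monad (Over O)} (c f w c' f' w') (α : m ≅ m') :
    (⟨O, m, c, f, w⟩ : SliceMonad.{u}) ≅ ⟨O, m', c', f', w'⟩ where
  hom := verticalHom α.hom (equifibered_of_iso α)
  inv := verticalHom α.inv (equifibered_of_iso α.symm)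
  hom_inv_id := by
    refine Hom.ext (Category.id_comp (𝟙 O)) ((verticalTrans_comp _ _).trans (heq_of_eq ?_))
    refine Eq.trans ?_ (verticalTrans_id m.toFunctor)
    exact congrArg verticalTrans ((monadToFunctor _).mapIso α).hom_inv_id
  inv_hom_id := by
    refine Hom.ext (Category.id_comp (𝟙 O)) ((verticalTrans_comp _ _).trans (heq_of_eq ?_))
    refine Eq.trans ?_ (verticalTrans_id m'.toFunctor)
    exact congrArg verticalTrans ((monadToFunctor _).mapIso α).inv_hom_id

/-- A monad is isomorphic to its transport along an isomorphism of functors. -/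
def transportIso {C : Type*} [Category* C] {F : C ⥤ C} (T : Monad C)
    (i : T.toFunctor ≅ F) : T ≅ T.transport i :=
  MonadIso.mk i (fun _ => rfl) (fun X => by
    simp [Monad.transport, ← Functor.map_comp_assoc])

/-! ### Every cartesian monad comes from a multicategory -/

/-- A cartesian monad structure on the polynomial functor of `A` comes from a monoid structure on
`A`, as its unit and multiplication are cartesian transformations of polynomial functors. -/
theorem exists_multicat (A : Signature O) (P : Monad (Over O)) (hP : P.toFunctor = poly A)
    (hη : NatTrans.Equifibered P.η) (hμ : NatTrans.Equifibered P.μ) :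
    ∃ M : AmalgMulticat.{u}, ∃ _ : M.obj = O, HEq M.monad P := by
  obtain ⟨F, η, μ, hassoc, hleft, hright⟩ := P
  obtain rfl : F = poly A := hP
  obtain ⟨i, hi⟩ := exists_polyTrans_eq ((unitIso O).inv ≫ η)
    ((NatTrans.Equifibered.of_isIso _).comp hη)
  obtain ⟨m, hm⟩ := exists_polyTrans_eq ((nestIso A A).inv ≫ μ)
    ((NatTrans.Equifibered.of_isIso (nestIso A A).inv).comp hμ)
  rw [Iso.inv_comp_eq] at hi hm
  subst hi hm
  exact ⟨
    { obj := O
      sig := A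
      mul := m
      one := i
      mul_assoc := Eval.mul_assoc_iff.2 fun X p e => (left_congr (hassoc (Over.mk (↾p))) e).symm
      one_mul := Eval.one_mul_iff.2 fun X p e => left_congr (hleft (Over.mk (↾p))) e
      mul_one := Eval.mul_one_iff.2 fun X p e => left_congr (hright (Over.mk (↾p))) e },
    rfl, HEq.rfl⟩

/-- Every finitary cartesian monad on `Set/O` preserving wide pullbacks is the monad of a
multicategory over `O`, up to an isomorphism over the identity of `O`. -/
theorem exists_iso_toSliceMonad (S : SliceMonad.{u}) :
    ∃ (M : AmalgMulticat.{u}) (h : M.obj = S.obj) (e : AmalgMulticat.toSliceMonad M ≅ S),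
      e.hom.base = eqToHom h := by
  obtain ⟨O, m, c, f, w⟩ := S
  have := c.preservesPullbacks
  obtain ⟨A, ⟨α⟩⟩ := exists_poly_iso m.toFunctor
  obtain ⟨M, h, hM⟩ := exists_multicat A (m.transport α.symm) rfl
    (c.unit_cartesian.comp (NatTrans.Equifibered.of_isIso α.inv))
    ((NatTrans.Equifibered.of_isIso (NatIso.hcomp α α).hom).comp
      (c.mul_cartesian.comp (NatTrans.Equifibered.of_isIso α.inv)))
  subst h
  have e : M.monad ≅ m := eqToIso hM.eq ≪≫ (transportIso m α.symm).symm
  exact ⟨M, rfl, verticalIso _ _ _ _ _ _ e, by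
    rw [eqToHom_refl]
    rfl⟩

end SliceMonad

namespace Signature

variable {O Q R : Type u}

/-! ### Restriction of signatures along a map of sets of types -/

/-- An operation of the restriction of a signature `B` along `v`: an operation of `B` with lifts of
its types along `v`. -/
structure RestrictOp (v : O → Q) (B : Signature Q) where
  op : B.Op
  out : O
  inp : Fin (B.arity op) → O
  out_op : B.out op = v out
  inp_op : ∀ i, B.inp op i = v (inp i)

/-- The restriction of a signature along a map of sets of types. -/
def restrict (v : O → Q) (B : Signature Q) : Signature O where
  Op := RestrictOp v B
  arity b := B.arity b.op
  out b := b.out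
  inp b := b.inp

/-- The cartesian morphism from the restriction of a signature. -/
def fromRestrict (v : O → Q) (B : Signature Q) : SigHom v (restrict v B) B where
  toFun b := b.op
  amalg _ := Equiv.refl _
  out_toFun b := b.out_op
  inp_toFun b := b.inp_op

/-- The universal property of the restriction of a signature. -/
def toRestrict {v : O → Q} {B : Signature Q} {t : R → O} {A : Signature R}
    (f : SigHom (fun x => v (t x)) A B) : SigHom t A (restrict v B) where
  toFun a :=
    { op := f.toFun a
      out := t (A.out a)
      inp := fun j => t (A.inp a (f.amalg a j))
      out_op := f.out_toFun a
      inp_op := f.inp_toFun a }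
  amalg := f.amalg
  out_toFun _ := rfl
  inp_toFun _ _ := rfl

namespace Eval

theorem restrict_ext {v : O → Q} {B : Signature Q} {X : Type w} {p : X → O}
    {e e' : Eval (restrict v B) p} (ho : e.out = e'.out)
    (h : map (q := fun x => v (p x)) (fromRestrict v B) (fun x => x) (fun _ => rfl) e =
      map (fromRestrict v B) (fun x => x) (fun _ => rfl) e') : e = e' := by
  obtain ⟨⟨b, o, y, hb, hb'⟩, x, hx⟩ := e
  obtain ⟨⟨c, o', y', hc, hc'⟩, x', hx'⟩ := e'
  obtain rfl : b = c := congrArg Eval.op h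
  obtain rfl : o = o' := ho
  obtain rfl : x = x' := funext (arg_eq_of_mk_eq (A := B) (a := b) h)
  obtain rfl : y = y' := funext fun i => (hx i).symm.trans (hx' i)
  rfl

end Eval

theorem restrict_hom_ext {v : O → Q} {B : Signature Q} {t : R → O} {A : Signature R}
    {f g : SigHom t A (restrict v B)}
    (h : f.comp (fromRestrict v B) = g.comp (fromRestrict v B)) : f = g := by
  refine Eval.sigHom_ext fun a => Eval.restrict_ext ?_ ?_
  · rw [Eval.out_map, Eval.out_map]
  · exact congrArg (fun k : SigHom (fun x => v (t x)) A B =>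
      Eval.map (q := fun i => v (t (Eval.inpFamily A a i))) k (fun i => i) (fun _ => rfl)
        (Eval.generic A a)) h

end Signature

/-! ### Multicategories are fibred over sets -/

namespace AmalgMulticat

open Signature

variable {O : Type u} (N : AmalgMulticat.{u}) (v : O → N.obj)

/-- The multiplication of the restriction of a multicategory. -/
def restrictMul : SigHom (fun x => x) (tensor (restrict v N.sig) (restrict v N.sig))
    (restrict v N.sig) :=
  toRestrict (t := fun x => x)
    ((tensorHom (fromRestrict v N.sig) (fromRestrict v N.sig)).comp N.mul)

/-- The unit of the restriction of a multicategory. -/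
def restrictOne : SigHom (fun x => x) (Signature.unit O) (restrict v N.sig) :=
  toRestrict (t := fun x => x) ((unitHom v).comp N.one)

theorem restrictMul_comp : (restrictMul N v).comp (fromRestrict v N.sig) =
    (tensorHom (fromRestrict v N.sig) (fromRestrict v N.sig)).comp N.mul :=
  rfl

theorem restrictOne_comp : (restrictOne N v).comp (fromRestrict v N.sig) =
    (unitHom v).comp N.one :=
  rfl

/-- The restriction of a multicategory along a map of sets of types. -/
def restrict : AmalgMulticat.{u} where
  obj := O
  sig := Signature.restrict v N.sig
  mul := restrictMul N v
  one := restrictOne N v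
  mul_assoc := Eval.mul_assoc_iff.2 fun X p e => by
    refine Eval.restrict_ext ?_ ?_
    · simp only [Eval.out_mul, Eval.out_map]
    · have h := Eval.mul_assoc_iff.1 N.mul_assoc X (fun x => v (p x))
        (Eval.map (fromRestrict v N.sig) (Eval.map (fromRestrict v N.sig)
          (Eval.map (fromRestrict v N.sig) (fun x => x) (fun _ => rfl)) (Eval.out_map _ _ _))
            (Eval.out_map _ _ _) e)
      rw [Eval.map_mul (restrictMul_comp N v), Eval.map_mul (restrictMul_comp N v),
        Eval.map_mul (restrictMul_comp N v), h]
      refine congrArg (Eval.mul N.mul) ?_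
      symm
      exact Eval.ext_arg fun j =>
        Eval.map_mul (restrictMul_comp N v) (fun x => x) (fun _ => rfl) (e.arg j)
  one_mul := Eval.one_mul_iff.2 fun X p e => by
    refine Eval.restrict_ext ?_ ?_
    · simp only [Eval.out_mul, Eval.out_one]
    · rw [Eval.map_mul (restrictMul_comp N v), Eval.map_one (restrictOne_comp N v)]
      exact Eval.one_mul_iff.1 N.one_mul X (fun x => v (p x)) _
  mul_one := Eval.mul_one_iff.2 fun X p e => by
    refine Eval.restrict_ext ?_ ?_
    · simp only [Eval.out_mul, Eval.out_map]
    · rw [Eval.map_mul (restrictMul_comp N v)]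
      refine Eq.trans ?_ (Eval.mul_one_iff.1 N.mul_one X (fun x => v (p x)) _)
      refine congrArg (Eval.mul N.mul) ?_
      symm
      exact Eval.ext_arg fun j =>
        (Eval.map_one (restrictOne_comp N v) (fun x => x) (fun _ => rfl) (e.arg j)).symm

/-- The prone morphism from the restriction of a multicategory. -/
def fromRestrict : restrict N v ⟶ N :=
  ({ base := v
     hom := Signature.fromRestrict v N.sig
     mul_hom := restrictMul_comp N v
     one_hom := restrictOne_comp N v } : Hom (restrict N v) N)

/-- A morphism of multicategories whose map of types factors through `v` factors through the
restriction along `v`. -/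
def toRestrict {M : AmalgMulticat.{u}} (t : M.obj → O)
    (f : SigHom (fun x => v (t x)) M.sig N.sig)
    (hmul : M.mul.comp f = (tensorHom f f).comp N.mul)
    (hone : M.one.comp f = (unitHom fun x => v (t x)).comp N.one) : M ⟶ restrict N v :=
  ({ base := t
     hom := Signature.toRestrict f
     mul_hom := restrict_hom_ext (hmul.trans
       (congrArg (fun g : SigHom (fun x => v (t x)) _ _ => g.comp N.mul)
         (tensorHom_comp (Signature.toRestrict f) (Signature.fromRestrict v N.sig)
           (Signature.toRestrict f) (Signature.fromRestrict v N.sig))))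
     one_hom := restrict_hom_ext hone } : Hom M (restrict N v))

theorem isFibered_proj : proj.{u}.IsFibered := by
  refine Functor.IsFibered.of_exists_isStronglyCartesian fun N O v => ?_
  refine ⟨restrict N v, fromRestrict N v, ?_⟩
  refine @Functor.IsStronglyCartesian.mk _ _ _ _ proj _ _ _ _ v (fromRestrict N v)
    (IsHomLift.map proj (fromRestrict N v)) fun {M} t f hf => ?_
  have hb : t ≫ v = ↾f.base := IsHomLift.eq_of_isHomLift proj _ f
  obtain ⟨s, f, hmul, hone⟩ := f
  obtain rfl : s = fun x => v (t x) := funext fun x => (ConcreteCategory.congr_hom hb x).symm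
  refine ⟨toRestrict N v t f hmul hone, ⟨?_, rfl⟩, ?_⟩
  · exact IsHomLift.map proj (toRestrict N v t f hmul hone)
  · rintro ⟨t', g, hg, hg'⟩ ⟨ht, hgf⟩
    have ht' : t = ↾t' := @IsHomLift.eq_of_isHomLift _ _ _ _ proj _ _ _ _ ht
    obtain rfl : t' = t := funext fun x => (ConcreteCategory.congr_hom ht' x).symm
    refine Hom.ext rfl (heq_of_eq (restrict_hom_ext ?_))
    exact (Hom.mk.inj hgf).2.eq

end AmalgMulticat

/-! ### Equivalences over a base -/

namespace FibredEquivalence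

variable {𝒮 𝒳 𝒴 : Type*} [Category* 𝒮] [Category* 𝒳] [Category* 𝒴]

theorem isHomLift_comp_iff (F : 𝒳 ⥤ 𝒴) (q : 𝒴 ⥤ 𝒮) {R S : 𝒮} (f : R ⟶ S) {x x' : 𝒳}
    (φ : x ⟶ x') : (F ⋙ q).IsHomLift f φ ↔ q.IsHomLift f (F.map φ) :=
  ⟨fun _ => IsHomLift.of_fac' q f (F.map φ) (IsHomLift.domain_eq (F ⋙ q) f φ)
      (IsHomLift.codomain_eq (F ⋙ q) f φ) (IsHomLift.fac' (F ⋙ q) f φ),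
    fun _ => IsHomLift.of_fac' (F ⋙ q) f φ (IsHomLift.domain_eq q f (F.map φ))
      (IsHomLift.codomain_eq q f (F.map φ)) (IsHomLift.fac' q f (F.map φ))⟩

/-- A fully faithful functor over a base reflects prone morphisms. -/
theorem isStronglyCartesian_of_map (F : 𝒳 ⥤ 𝒴) (q : 𝒴 ⥤ 𝒮) [F.Full] [F.Faithful]
    {R S : 𝒮} (f : R ⟶ S) {x x' : 𝒳} (φ : x ⟶ x')
    (h : q.IsStronglyCartesian f (F.map φ)) : (F ⋙ q).IsStronglyCartesian f φ where
  toIsHomLift := (isHomLift_comp_iff F q f φ).2 h.toIsHomLift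
  universal_property' {z} g ψ hψ := by
    have := (isHomLift_comp_iff F q _ ψ).1 hψ
    obtain ⟨χ, ⟨hχ, hχ'⟩, huniq⟩ := h.universal_property' g (F.map ψ)
    refine ⟨F.preimage χ, ⟨?_, ?_⟩, fun k hk => ?_⟩
    · rw [isHomLift_comp_iff, F.map_preimage]
      exact hχ
    · apply F.map_injective
      rw [F.map_comp, F.map_preimage, hχ']
    · apply F.map_injective
      rw [F.map_preimage]
      refine huniq _ ⟨(isHomLift_comp_iff F q g k).1 hk.1, ?_⟩
      rw [← F.map_comp, hk.2]

/-- A fully faithful functor over a base which is essentially surjective up to vertical isomorphisms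
preserves prone morphisms. -/
theorem map_isStronglyCartesian (F : 𝒳 ⥤ 𝒴) (q : 𝒴 ⥤ 𝒮) [F.Full] [F.Faithful]
    (G : 𝒴 → 𝒳) (i : ∀ y, F.obj (G y) ≅ y)
    (hi : ∀ y, q.IsHomLift (𝟙 (q.obj y)) (i y).hom)
    {R S : 𝒮} (f : R ⟶ S) {x x' : 𝒳} (φ : x ⟶ x')
    (h : (F ⋙ q).IsStronglyCartesian f φ) : q.IsStronglyCartesian f (F.map φ) where
  toIsHomLift := (isHomLift_comp_iff F q f φ).1 h.toIsHomLift
  universal_property' {z} g ψ hψ := by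
    have := hi z
    have hz : q.obj (F.obj (G z)) = q.obj z := IsHomLift.domain_eq q (𝟙 (q.obj z)) (i z).hom
    have h₁ : q.IsHomLift (eqToHom hz) (i z).hom :=
      IsHomLift.of_fac' q _ _ rfl rfl (by
        rw [IsHomLift.fac' q (𝟙 (q.obj z)) (i z).hom]
        simp)
    have h₂ : q.IsHomLift (eqToHom hz.symm) (i z).inv := by
      refine IsHomLift.of_fac' q _ _ rfl rfl ?_
      rw [IsHomLift.fac' q (𝟙 (q.obj z)) (i z).inv]
      simp
    have h₃ : (F ⋙ q).IsHomLift ((eqToHom hz ≫ g) ≫ f) (F.preimage ((i z).hom ≫ ψ)) := by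
      rw [isHomLift_comp_iff, F.map_preimage, Category.assoc]
      infer_instance
    obtain ⟨χ, ⟨hχ, hχ'⟩, huniq⟩ := h.universal_property' (eqToHom hz ≫ g)
      (F.preimage ((i z).hom ≫ ψ))
    refine ⟨(i z).inv ≫ F.map χ, ⟨?_, ?_⟩, fun k hk => ?_⟩
    · have := (isHomLift_comp_iff F q _ χ).1 hχ
      have h₄ : q.IsHomLift (eqToHom hz.symm ≫ eqToHom hz ≫ g) ((i z).inv ≫ F.map χ) :=
        inferInstance
      simpa using h₄
    · rw [Category.assoc, ← F.map_comp, hχ', F.map_preimage, Iso.inv_hom_id_assoc]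
    · have := hk.1
      rw [Iso.eq_inv_comp, ← huniq (F.preimage ((i z).hom ≫ k)) ⟨?_, ?_⟩, F.map_preimage]
      · rw [isHomLift_comp_iff, F.map_preimage]
        infer_instance
      · apply F.map_injective
        rw [F.map_comp, F.map_preimage, F.map_preimage, Category.assoc, hk.2]

/-- The equivalence given by a fully faithful functor and a choice of preimages of objects. -/
noncomputable def equivOfIso (F : 𝒳 ⥤ 𝒴) [F.Full] [F.Faithful]
    (G : 𝒴 → 𝒳) (i : ∀ y, F.obj (G y) ≅ y) : 𝒳 ≌ 𝒴 where
  functor := F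
  inverse :=
    { obj := G
      map := fun {y y'} ψ => F.preimage ((i y).hom ≫ ψ ≫ (i y').inv)
      map_id := fun y => F.map_injective (by simp)
      map_comp := fun ψ ψ' => F.map_injective (by simp) }
  unitIso := NatIso.ofComponents (fun x => F.preimageIso (i (F.obj x)).symm)
    (fun φ => F.map_injective (by simp))
  counitIso := NatIso.ofComponents i (fun ψ => by simp)
  functor_unitIso_comp x := by simp

/-- The prone lift of `f` at `y` is the image of the prone lift at `G y`, followed by the vertical
isomorphism onto `y`. -/
theorem isFibered_of_comp (F : 𝒳 ⥤ 𝒴) (q : 𝒴 ⥤ 𝒮) [F.Full] [F.Faithful]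
    (G : 𝒴 → 𝒳) (i : ∀ y, F.obj (G y) ≅ y)
    (hi : ∀ y, q.IsHomLift (𝟙 (q.obj y)) (i y).hom) (h : (F ⋙ q).IsFibered) : q.IsFibered := by
  refine Functor.IsFibered.of_exists_isStronglyCartesian fun y R f => ?_
  have := hi y
  have hy : q.obj (F.obj (G y)) = q.obj y := IsHomLift.domain_eq q (𝟙 (q.obj y)) (i y).hom
  have h₁ : q.IsHomLift (eqToHom hy) (i y).hom :=
    IsHomLift.of_fac' q _ _ rfl rfl (by
      rw [IsHomLift.fac' q (𝟙 (q.obj y)) (i y).hom]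
      simp)
  let φ := Functor.IsPreFibered.pullbackMap (p := F ⋙ q) (a := G y) rfl (f ≫ eqToHom hy.symm)
  have hφ : (F ⋙ q).IsStronglyCartesian (f ≫ eqToHom hy.symm) φ := inferInstance
  have h₂ := map_isStronglyCartesian F q G i hi _ φ hφ
  have h₃ : q.IsStronglyCartesian ((f ≫ eqToHom hy.symm) ≫ eqToHom hy) (F.map φ ≫ (i y).hom) :=
    inferInstance
  refine ⟨_, F.map φ ≫ (i y).hom, ?_⟩
  simpa using h₃

/-- A fully faithful functor over a base, with vertical isomorphisms exhibiting its essential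
surjectivity, gives an equivalence over the base. -/
noncomputable def ofFullyFaithful (F : 𝒳 ⥤ 𝒴) (q : 𝒴 ⥤ 𝒮) [F.Full] [F.Faithful]
    (G : 𝒴 → 𝒳) (i : ∀ y, F.obj (G y) ≅ y)
    (hi : ∀ y, q.IsHomLift (𝟙 (q.obj y)) (i y).hom) : FibredEquivalence (F ⋙ q) q where
  equiv := equivOfIso F G i
  functor_comp := rfl
  inverse_comp := by
    refine CategoryTheory.Functor.ext
      (fun y => @IsHomLift.domain_eq _ _ _ _ q _ _ _ _ _ _ (hi y)) fun y y' ψ => ?_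
    have := hi y
    have := hi y'
    change q.map (F.map (F.preimage ((i y).hom ≫ ψ ≫ (i y').inv))) = _
    rw [F.map_preimage, q.map_comp, q.map_comp, IsHomLift.fac' q (𝟙 (q.obj y)) (i y).hom,
      IsHomLift.fac' q (𝟙 (q.obj y')) (i y').inv, Category.id_comp, Category.id_comp,
      eqToHom_trans, eqToHom_trans]
    rfl
  unit_vertical x := by
    have := hi (F.obj x)
    rw [isHomLift_comp_iff]
    change q.IsHomLift _ (F.map (F.preimage (i (F.obj x)).inv))
    rw [F.map_preimage]
    exact IsHomLift.lift_id_inv q (q.obj (F.obj x)) (i (F.obj x))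
  counit_vertical y := hi y
  functor_prone f _ _ φ h := map_isStronglyCartesian F q G i hi f φ h
  inverse_prone {R S} f {y y'} ψ h := by
    refine isStronglyCartesian_of_map F q f _ ?_
    have hy := hi y
    have hy' := hi y'
    obtain rfl := IsHomLift.domain_eq q f ψ
    obtain rfl := IsHomLift.codomain_eq q f ψ
    have h₁ : q.IsStronglyCartesian (𝟙 (q.obj y)) (i y).hom := inferInstance
    have h₂ : q.IsStronglyCartesian (𝟙 (q.obj y')) (i y').inv := inferInstance
    have h₃ : q.IsStronglyCartesian (𝟙 (q.obj y) ≫ f ≫ 𝟙 (q.obj y'))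
      ((i y).hom ≫ ψ ≫ (i y').inv) := inferInstance
    change q.IsStronglyCartesian f (F.map (F.preimage ((i y).hom ≫ ψ ≫ (i y').inv)))
    rw [F.map_preimage]
    simpa using h₃

end FibredEquivalence

theorem mainTheorem4 :
    AmalgMulticat.proj.{u}.IsFibered ∧ SliceMonad.toBase.{u}.IsFibered ∧
      Nonempty (FibredEquivalence AmalgMulticat.proj.{u} SliceMonad.toBase.{u}) := by
  choose G hG i hi using SliceMonad.exists_iso_toSliceMonad.{u}
  have hi' (S : SliceMonad.{u}) :
      SliceMonad.toBase.IsHomLift (𝟙 (SliceMonad.toBase.obj S)) (i S).hom :=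
    IsHomLift.of_fac' _ _ _ (hG S) rfl ((hi S).trans (by
      rw [Category.id_comp]
      exact (Category.comp_id _).symm))
  exact ⟨AmalgMulticat.isFibered_proj,
    FibredEquivalence.isFibered_of_comp AmalgMulticat.toSliceMonadFunctor SliceMonad.toBase G i hi'
      AmalgMulticat.isFibered_proj,
    ⟨FibredEquivalence.ofFullyFaithful AmalgMulticat.toSliceMonadFunctor SliceMonad.toBase G i
      hi'⟩⟩
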